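/- Let $A$ be a (not necessarily unital) C*-algebra and let $H$ be a (right) Hilbert $A$-module, with $A$-valued inner product $\langle\cdot,\cdot\rangle$ linear in the second variable and norm $\|x\|=\|\langle x,x\rangle\|^{1/2}$. Let $\pi_U:A\to B(H_U)$ be the universal representation of $A$ (the direct sum of the GNS representations of all states of $A$), and identify $A^{**}$ with the enveloping von Neumann algebra $\pi_U(A)''\subseteq B(H_U)$ and $A$ with $\pi_U(A)$. Let $H\bullet A^{**}$ be the Hilbert $A^{**}$-module obtained from the algebraic tensor product $H\otimes_{\mathbb C} A^{**}$, with the $A^{**}$-valued form determined by $\langle x\otimes a,\,y\otimes b\rangle=a^*\langle x,y\rangle b$, by dividing out $\{z:\langle z,z\rangle=0\}$ and completing; regard $H$ as a submodule of $H\bullet A^{**}$ through $x\mapsto x\otimes 1$. Let $\mathcal T_{su}$ be the topology on $H\bullet A^{**}$ generated by the sets $$N_{\xi,\varepsilon,V}=\{z\in H\bullet A^{**}:\ \|\langle \xi-z,\xi-z\rangle v\|<\varepsilon\ \text{ for all } v\in V\},$$ where $\xi\in H\bullet A^{**}$, $\varepsilon>0$ and $V\subset H_U$ is finite. Then the (closed)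 unit ball of $H$ is contained in the (closed) unit ball of $H\bullet A^{**}$ and is dense in it in the topology $\mathcal T_{su}$. In particular, for every $\xi\in H\bullet A^{**}$ with $\|\xi\|\le 1$ there is a net $(x_\alpha)$ in $H$ with $\|x_\alpha\|\le 1$ such that $\lim_\alpha\|\langle \xi-x_\alpha,\xi-x_\alpha\rangle v\|=0$ for all $v\in H_U$. -/

import Mathlib

open scoped TensorProduct ComplexOrder Topology

noncomputable section

set_option linter.unusedSectionVars false

namespace HilbertMod

universe u v w

/-! ### Right Hilbert modules -/

/-- A right inner product module over a (possibly non-unital) C⋆-algebra `A`: a complex normed space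
`H` with a right action of `A` (written `MulOpposite.op a • x` for `x · a`) and an `A`-valued inner
product, linear in the second variable, whose associated norm `‖⟪x, x⟫‖ ^ (1/2)` is the norm of `H`.
It is a *Hilbert* `A`-module when `H` is moreover complete, i.e. when `[CompleteSpace H]` holds.
(Mathlib's `CStarModule` is the notion for left actions.) -/
class HilbertModule (A : Type u) (H : Type v) [NonUnitalCStarAlgebra A] [PartialOrder A]
    [NormedAddCommGroup H] [NormedSpace ℂ H] [SMul Aᵐᵒᵖ H] extends Inner A H where
  op_smul_add (a : A) (x y : H) :
    MulOpposite.op a • (x + y) = MulOpposite.op a • x + MulOpposite.op a • y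
  add_op_smul (a b : A) (x : H) :
    MulOpposite.op (a + b) • x = MulOpposite.op a • x + MulOpposite.op b • x
  mul_op_smul (a b : A) (x : H) :
    MulOpposite.op (a * b) • x = MulOpposite.op b • (MulOpposite.op a • x)
  op_smul_smul (a : A) (c : ℂ) (x : H) :
    MulOpposite.op a • (c • x) = c • (MulOpposite.op a • x)
  smul_op_smul (a : A) (c : ℂ) (x : H) :
    MulOpposite.op (c • a) • x = c • (MulOpposite.op a • x)
  inner_add_right (x y z : H) : inner x (y + z) = inner x y + inner x z
  inner_smul_right (c : ℂ) (x y : H) : inner x (c • y) = c • inner x y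
  inner_op_smul_right (a : A) (x y : H) : inner x (MulOpposite.op a • y) = inner x y * a
  star_inner (x y : H) : star (inner x y) = inner y x
  inner_self_nonneg (x : H) : 0 ≤ inner x x
  eq_zero_of_inner_self (x : H) : inner x x = 0 → x = 0
  norm_eq_sqrt (x : H) : ‖x‖ = √‖inner x x‖

namespace HilbertModule

variable {A : Type u} {H : Type v} [NonUnitalCStarAlgebra A] [PartialOrder A]
  [NormedAddCommGroup H] [NormedSpace ℂ H] [SMul Aᵐᵒᵖ H] [HilbertModule A H]

theorem inner_add_left (x y z : H) : inner A (x + y) z = inner A x z + inner A y z := by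
  rw [← star_inner z (x + y), inner_add_right, star_add, star_inner, star_inner]

theorem inner_smul_left (c : ℂ) (x y : H) : inner A (c • x) y = star c • inner A x y := by
  rw [← star_inner y (c • x), inner_smul_right, star_smul, star_inner]

theorem inner_op_smul_left (a : A) (x y : H) :
    inner A (MulOpposite.op a • x) y = star a * inner A x y := by
  rw [← star_inner y, inner_op_smul_right, star_mul, star_inner]

theorem inner_sum_right {ι : Type*} (s : Finset ι) (x : H) (f : ι → H) :
    inner A x (∑ i ∈ s, f i) = ∑ i ∈ s, inner A x (f i) :=
  map_sum (AddMonoidHom.mk' (fun y => inner A x y) (inner_add_right x)) f s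

theorem inner_sum_left {ι : Type*} (s : Finset ι) (f : ι → H) (x : H) :
    inner A (∑ i ∈ s, f i) x = ∑ i ∈ s, inner A (f i) x :=
  map_sum (AddMonoidHom.mk' (fun y => inner A y x) (fun y z => inner_add_left y z x)) f s

open scoped CStarAlgebra in
theorem exists_negPart {C : Type*} [NonUnitalCStarAlgebra C] [PartialOrder C] [StarOrderedRing C]
    (T : C) (hT : IsSelfAdjoint T) :
    ∃ N : C, 0 ≤ N ∧ T * N = -(N * N) ∧ (N = 0 → 0 ≤ T) := by
  refine ⟨T⁻, CFC.negPart_nonneg T, ?_, (CFC.negPart_eq_zero_iff T hT).mp⟩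
  calc T * T⁻ = (T⁺ - T⁻) * T⁻ := by rw [CFC.posPart_sub_negPart T hT]
    _ = _ := by rw [sub_mul, CFC.posPart_mul_negPart, zero_sub]

theorem exists_eq_star_mul_self {C : Type*} [NonUnitalCStarAlgebra C] [PartialOrder C]
    [StarOrderedRing C] {T : C} (hT : 0 ≤ T) : ∃ S : C, T = star S * S :=
  CStarAlgebra.nonneg_iff_eq_star_mul_self.mp hT

/-- A Gram matrix in a Hilbert module is of the form `S⋆ S`. -/
theorem exists_gram_eq [StarOrderedRing A] {n : ℕ} (h : Fin n → H) :
    ∃ S : Fin n → Fin n → A, ∀ i j, inner A (h i) (h j) = ∑ k, star (S k i) * S k j := by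
  classical
  let T : CStarMatrix (Fin n) (Fin n) A := CStarMatrix.ofMatrix fun i j => inner A (h i) (h j)
  have hTapp : ∀ i j, T i j = inner A (h i) (h j) := fun i j => rfl
  have hT : IsSelfAdjoint T := by
    rw [isSelfAdjoint_iff]
    ext i j
    rw [CStarMatrix.star_apply, hTapp, hTapp, star_inner]
  obtain ⟨N, hN0, h1, hNT⟩ := exists_negPart T hT
  have hNsa : star N = N := (IsSelfAdjoint.of_nonneg hN0).star_eq
  obtain ⟨R, hR⟩ := exists_eq_star_mul_self hN0
  have hNTN : N * T * N = -(star (R * N) * (R * N)) := by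
    calc N * T * N = -(N * N * N) := by rw [mul_assoc, h1, mul_neg, mul_assoc]
      _ = -(star N * (star R * R) * N) := by rw [← hR, hNsa]
      _ = _ := by rw [star_mul]; simp only [mul_assoc]
  have hRN : R * N = 0 := by
    ext i k
    have hd : (N * T * N) k k = inner A (∑ j, MulOpposite.op (N j k) • h j)
        (∑ j, MulOpposite.op (N j k) • h j) := by
      simp only [inner_sum_left, inner_sum_right, inner_op_smul_left, inner_op_smul_right]
      rw [CStarMatrix.mul_apply]
      simp only [CStarMatrix.mul_apply, Finset.sum_mul]
      refine Finset.sum_congr rfl fun a _ => Finset.sum_congr rfl fun b _ => ?_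
      rw [hTapp, ← CStarMatrix.star_apply, hNsa, mul_assoc]
    have hpos : 0 ≤ (N * T * N) k k := by rw [hd]; exact inner_self_nonneg _
    rw [hNTN, CStarMatrix.neg_apply, CStarMatrix.mul_apply] at hpos
    simp only [CStarMatrix.star_apply] at hpos
    have hz : ∑ j, star ((R * N) j k) * (R * N) j k = 0 :=
      le_antisymm (by simpa using hpos) (Finset.sum_nonneg fun j _ => star_mul_self_nonneg _)
    have := (Finset.sum_eq_zero_iff_of_nonneg fun j _ => star_mul_self_nonneg _).mp hz i
      (Finset.mem_univ i)
    simpa using CStarRing.star_mul_self_eq_zero_iff _ |>.mp this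
  have hNN : N * N = 0 := by
    calc N * N = star R * R * N := by rw [← hR]
      _ = 0 := by rw [mul_assoc, hRN, mul_zero]
  have hNz : N = 0 := by
    rw [← CStarRing.star_mul_self_eq_zero_iff, hNsa, hNN]
  have hT0 : 0 ≤ T := hNT hNz
  obtain ⟨S, hS⟩ := exists_eq_star_mul_self hT0
  refine ⟨fun k i => S k i, fun i j => ?_⟩
  rw [← hTapp, hS, CStarMatrix.mul_apply]
  simp only [CStarMatrix.star_apply]

end HilbertModule

/-! ### Extension of scalars `H • B` -/

section Extension

variable {A : Type u} {B : Type w} [NonUnitalCStarAlgebra A] [PartialOrder A]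
  [CStarAlgebra B] [PartialOrder B]

set_option linter.unusedVariables false in
/-- The algebraic tensor product `H ⊗ B` over `ℂ`, which will carry the semi-inner product
induced by the inner product of `H` and the ⋆-homomorphism `φ : A → B`. -/
@[nolint unusedArguments]
def PreExt (φ : A →⋆ₙₐ[ℂ] B) (H : Type v) [NormedAddCommGroup H] [NormedSpace ℂ H] :
    Type (max v w) := H ⊗[ℂ] B

variable (φ : A →⋆ₙₐ[ℂ] B) (H : Type v) [NormedAddCommGroup H] [NormedSpace ℂ H]

instance : AddCommGroup (PreExt φ H) := inferInstanceAs (AddCommGroup (H ⊗[ℂ] B))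
instance : Module ℂ (PreExt φ H) := inferInstanceAs (Module ℂ (H ⊗[ℂ] B))

/-- The elementary tensor `x ⊗ b`. -/
def PreExt.tmul {H : Type v} [NormedAddCommGroup H] [NormedSpace ℂ H] (x : H) (b : B) :
    PreExt φ H := x ⊗ₜ[ℂ] b

/-- The right action of `B`, determined by `(x ⊗ a) · b = x ⊗ (a b)`. -/
def PreExt.rmul (b : B) : PreExt φ H →ₗ[ℂ] PreExt φ H :=
  (LinearMap.lTensor H (LinearMap.mulRight ℂ b) : H ⊗[ℂ] B →ₗ[ℂ] H ⊗[ℂ] B)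

instance : SMul Bᵐᵒᵖ (PreExt φ H) := ⟨fun b z => PreExt.rmul φ H b.unop z⟩

variable [SMul Aᵐᵒᵖ H] [HilbertModule A H]

/-- The semi-inner product on `H ⊗ B`, determined by `⟪x ⊗ a, y ⊗ b⟫ = a⋆ φ(⟪x, y⟫) b`. -/
def PreExt.form : PreExt φ H →ₗ⋆[ℂ] PreExt φ H →ₗ[ℂ] B :=
  (TensorProduct.lift (LinearMap.mk₂'ₛₗ (starRingEnd ℂ) (starRingEnd ℂ)
    (fun (x : H) (a : B) => TensorProduct.lift (LinearMap.mk₂ ℂ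
      (fun (y : H) (b : B) => star a * φ (inner A x y) * b)
      (by intros; simp [HilbertModule.inner_add_right, mul_add, add_mul])
      (by intros; simp [HilbertModule.inner_smul_right])
      (by intros; simp [mul_add])
      (by intros; simp)))
    (by intros; ext; simp [HilbertModule.inner_add_left, mul_add, add_mul])
    (by intros; ext; simp [HilbertModule.inner_smul_left])
    (by intros; ext; simp [add_mul])
    (by intros; ext; simp)) : H ⊗[ℂ] B →ₗ⋆[ℂ] H ⊗[ℂ] B →ₗ[ℂ] B)

instance : Inner B (PreExt φ H) := ⟨fun z w => PreExt.form φ H z w⟩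

namespace PreExt

theorem inner_tmul (x y : H) (a b : B) :
    inner B (tmul φ x a) (tmul φ y b) = star a * φ (inner A x y) * b := rfl

theorem op_smul_tmul (x : H) (a b : B) :
    MulOpposite.op b • tmul φ x a = tmul φ x (a * b) := rfl

variable {φ H}

theorem exists_eq_sum (z : PreExt φ H) :
    ∃ (n : ℕ) (x : Fin n → H) (b : Fin n → B), z = ∑ i, tmul φ (x i) (b i) :=
  TensorProduct.exists_sum_tmul_eq (R := ℂ) (M := H) (N := B) z

theorem inner_add_right (x y z : PreExt φ H) : inner B x (y + z) = inner B x y + inner B x z :=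
  map_add (form φ H x) y z

theorem inner_add_left (x y z : PreExt φ H) : inner B (x + y) z = inner B x z + inner B y z :=
  LinearMap.map_add₂ (form φ H) x y z

theorem inner_smul_right (c : ℂ) (x y : PreExt φ H) : inner B x (c • y) = c • inner B x y :=
  map_smul (form φ H x) c y

theorem inner_sum_right {ι : Type*} (s : Finset ι) (x : PreExt φ H) (f : ι → PreExt φ H) :
    inner B x (∑ i ∈ s, f i) = ∑ i ∈ s, inner B x (f i) :=
  map_sum (form φ H x) f s

theorem inner_sum_left {ι : Type*} (s : Finset ι) (f : ι → PreExt φ H) (x : PreExt φ H) :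
    inner B (∑ i ∈ s, f i) x = ∑ i ∈ s, inner B (f i) x :=
  map_sum (AddMonoidHom.mk' (fun y => inner B y x) (fun y z => inner_add_left y z x)) f s

theorem op_smul_add (b : B) (x y : PreExt φ H) :
    MulOpposite.op b • (x + y) = MulOpposite.op b • x + MulOpposite.op b • y :=
  map_add (rmul φ H b) x y

theorem op_smul_smul (b : B) (c : ℂ) (x : PreExt φ H) :
    MulOpposite.op b • (c • x) = c • (MulOpposite.op b • x) :=
  map_smul (rmul φ H b) c x

theorem op_smul_sum {ι : Type*} (b : B) (s : Finset ι) (f : ι → PreExt φ H) :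
    MulOpposite.op b • (∑ i ∈ s, f i) = ∑ i ∈ s, MulOpposite.op b • f i :=
  map_sum (rmul φ H b) f s

theorem add_op_smul (a b : B) (x : PreExt φ H) :
    MulOpposite.op (a + b) • x = MulOpposite.op a • x + MulOpposite.op b • x := by
  obtain ⟨n, x, c, rfl⟩ := exists_eq_sum x
  simp only [op_smul_sum, op_smul_tmul, mul_add, ← Finset.sum_add_distrib]
  exact Finset.sum_congr rfl fun i _ => TensorProduct.tmul_add _ _ _

theorem mul_op_smul (a b : B) (x : PreExt φ H) :
    MulOpposite.op (a * b) • x = MulOpposite.op b • (MulOpposite.op a • x) := by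
  obtain ⟨n, x, c, rfl⟩ := exists_eq_sum x
  simp only [op_smul_sum, op_smul_tmul, mul_assoc]

theorem smul_op_smul (a : B) (c : ℂ) (x : PreExt φ H) :
    MulOpposite.op (c • a) • x = c • (MulOpposite.op a • x) := by
  obtain ⟨n, x, d, rfl⟩ := exists_eq_sum x
  simp only [op_smul_sum, op_smul_tmul, Finset.smul_sum, mul_smul_comm]
  exact Finset.sum_congr rfl fun i _ => TensorProduct.tmul_smul _ _ _

theorem inner_op_smul_right (b : B) (x y : PreExt φ H) :
    inner B x (MulOpposite.op b • y) = inner B x y * b := by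
  obtain ⟨n, x, c, rfl⟩ := exists_eq_sum x
  obtain ⟨m, y, d, rfl⟩ := exists_eq_sum y
  simp only [op_smul_sum, inner_sum_left, inner_sum_right, op_smul_tmul, inner_tmul,
    Finset.sum_mul, mul_assoc]

theorem star_inner (x y : PreExt φ H) : star (inner B x y) = inner B y x := by
  obtain ⟨n, x, c, rfl⟩ := exists_eq_sum x
  obtain ⟨m, y, d, rfl⟩ := exists_eq_sum y
  simp only [inner_sum_left, inner_sum_right, inner_tmul, star_sum, star_mul, star_star,
    ← map_star, HilbertModule.star_inner, mul_assoc]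
  exact Finset.sum_comm

theorem inner_op_smul_left (b : B) (x y : PreExt φ H) :
    inner B (MulOpposite.op b • x) y = star b * inner B x y := by
  rw [← star_inner y, inner_op_smul_right, star_mul, star_inner]

theorem inner_smul_left (c : ℂ) (x y : PreExt φ H) : inner B (c • x) y = star c • inner B x y := by
  rw [← star_inner y, inner_smul_right, star_smul, star_inner]

variable [StarOrderedRing A] [StarOrderedRing B]

theorem inner_self_nonneg (z : PreExt φ H) : 0 ≤ inner B z z := by
  obtain ⟨n, x, b, rfl⟩ := exists_eq_sum z
  obtain ⟨S, hS⟩ := HilbertModule.exists_gram_eq (A := A) x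
  have : inner B (∑ i, tmul φ (x i) (b i)) (∑ i, tmul φ (x i) (b i)) =
      ∑ k, star (∑ i, φ (S k i) * b i) * (∑ i, φ (S k i) * b i) := by
    simp only [inner_sum_left, inner_sum_right, inner_tmul, hS, map_sum, map_mul, map_star,
      star_sum, star_mul, Finset.sum_mul, Finset.mul_sum]
    calc _ = ∑ j, ∑ k, ∑ i, star (b i) * (star (φ (S k i)) * φ (S k j)) * b j := by
            refine Finset.sum_congr rfl fun j _ => Finset.sum_comm
      _ = _ := by
            rw [Finset.sum_comm]
            simp only [mul_assoc]
  rw [this]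
  exact Finset.sum_nonneg fun k _ => star_mul_self_nonneg _

instance : Norm (PreExt φ H) := ⟨fun z => √‖inner B z z‖⟩

theorem norm_def (z : PreExt φ H) : ‖z‖ = √‖inner B z z‖ := rfl

theorem norm_sq (z : PreExt φ H) : ‖z‖ ^ 2 = ‖inner B z z‖ := Real.sq_sqrt (norm_nonneg _)

theorem zero_le_norm (z : PreExt φ H) : 0 ≤ ‖z‖ := Real.sqrt_nonneg _

theorem norm_inner_le (z w : PreExt φ H) : ‖inner B z w‖ ≤ ‖z‖ * ‖w‖ := by
  have key : ∀ t : ℝ, 0 < t → ‖w‖ ^ 2 ≤ t → ‖inner B z w‖ ^ 2 ≤ t * ‖z‖ ^ 2 := by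
    intro t ht hwt
    set c := inner B w z with hc
    have hcz : inner B z w = star c := by rw [hc, star_inner]
    have h0 : 0 ≤ inner B ((t : ℂ) • z + MulOpposite.op (-c) • w)
      ((t : ℂ) • z + MulOpposite.op (-c) • w) := inner_self_nonneg _
    have hexp : inner B ((t : ℂ) • z + MulOpposite.op (-c) • w)
        ((t : ℂ) • z + MulOpposite.op (-c) • w) =
        ((t ^ 2 : ℝ) • inner B z z - (2 * t) • (star c * c)) + star c * inner B w w * c := by
      simp only [inner_add_left, inner_add_right, inner_smul_left, inner_smul_right,
        inner_op_smul_left, inner_op_smul_right, hcz, ← hc, star_neg, neg_mul, mul_neg,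
        Complex.star_def, Complex.conj_ofReal, smul_neg, smul_mul_assoc, smul_smul,
        mul_assoc, smul_add, add_mul]
      simp only [← Complex.ofReal_mul, Complex.coe_smul]
      rw [two_mul, add_smul, pow_two]
      abel
    have hle : star c * inner B w w * c ≤ t • (star c * c) := by
      refine (CStarAlgebra.star_left_conjugate_le_norm_smul
        (hb := IsSelfAdjoint.of_nonneg (inner_self_nonneg w))).trans ?_
      rw [← norm_sq]
      exact smul_le_smul_of_nonneg_right hwt (star_mul_self_nonneg c)
    rw [hexp] at h0
    have h1 : t • (star c * c) ≤ (t ^ 2) • inner B z z := by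
      have h2 : 0 ≤ ((t ^ 2 : ℝ) • inner B z z - (2 * t) • (star c * c)) + t • (star c * c) :=
        h0.trans (by gcongr)
      rw [two_mul, add_smul] at h2
      rw [← sub_nonneg]
      convert h2 using 1
      abel
    have h3 := CStarAlgebra.norm_le_norm_of_nonneg_of_le
      (smul_nonneg ht.le (star_mul_self_nonneg c)) h1
    rw [norm_smul, norm_smul, CStarRing.norm_star_mul_self, ← norm_sq, Real.norm_of_nonneg ht.le,
      Real.norm_of_nonneg (by positivity)] at h3
    rw [hcz, norm_star]
    nlinarith [h3, ht]
  have hz := zero_le_norm z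
  have hw := zero_le_norm w
  have hsq : ‖inner B z w‖ ^ 2 ≤ (‖z‖ * ‖w‖) ^ 2 := by
    refine le_of_forall_pos_le_add fun ε hε => ?_
    have h1 := key (‖w‖ ^ 2 + ε / (‖z‖ ^ 2 + 1)) (by positivity) (by
      have : 0 < ε / (‖z‖ ^ 2 + 1) := by positivity
      linarith)
    have h2 : ε / (‖z‖ ^ 2 + 1) * ‖z‖ ^ 2 ≤ ε := by
      rw [div_mul_eq_mul_div, div_le_iff₀ (by positivity)]
      nlinarith
    nlinarith
  exact (pow_le_pow_iff_left₀ (norm_nonneg _) (mul_nonneg hz hw) two_ne_zero).mp hsq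

theorem seminormedCore : SeminormedSpace.Core ℂ (PreExt φ H) where
  norm_nonneg := zero_le_norm
  norm_smul c z := by
    rw [norm_def, norm_def, inner_smul_left, inner_smul_right, smul_smul, norm_smul, norm_mul,
      norm_star, Real.sqrt_mul (by positivity), Real.sqrt_mul_self (norm_nonneg c)]
  norm_triangle z w := by
    refine (pow_le_pow_iff_left₀ (zero_le_norm _)
      (add_nonneg (zero_le_norm z) (zero_le_norm w)) two_ne_zero).mp ?_
    rw [norm_sq, inner_add_left, inner_add_right, inner_add_right]
    calc _ ≤ (‖inner B z z‖ + ‖inner B z w‖) + (‖inner B w z‖ + ‖inner B w w‖) :=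
          (norm_add_le _ _).trans (add_le_add (norm_add_le _ _) (norm_add_le _ _))
      _ ≤ (‖z‖ ^ 2 + ‖z‖ * ‖w‖) + (‖w‖ * ‖z‖ + ‖w‖ ^ 2) := by
          rw [norm_sq, norm_sq]
          gcongr <;> exact norm_inner_le _ _
      _ = (‖z‖ + ‖w‖) ^ 2 := by ring

instance : SeminormedAddCommGroup (PreExt φ H) := SeminormedAddCommGroup.ofCore seminormedCore

instance : NormedSpace ℂ (PreExt φ H) where
  norm_smul_le c z := (seminormedCore.norm_smul c z).le

theorem norm_op_smul_le (b : B) (z : PreExt φ H) : ‖MulOpposite.op b • z‖ ≤ ‖b‖ * ‖z‖ := by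
  refine (pow_le_pow_iff_left₀ (zero_le_norm _)
      (mul_nonneg (norm_nonneg b) (zero_le_norm z)) two_ne_zero).mp ?_
  rw [norm_sq, inner_op_smul_left, inner_op_smul_right, mul_pow, norm_sq]
  calc _ ≤ ‖star b‖ * (‖inner B z z‖ * ‖b‖) :=
        (norm_mul_le _ _).trans (by gcongr; exact norm_mul_le _ _)
    _ = _ := by rw [norm_star]; ring

instance : UniformContinuousConstSMul Bᵐᵒᵖ (PreExt φ H) where
  uniformContinuous_const_smul b :=
    ((rmul φ H b.unop).mkContinuous ‖b.unop‖ (norm_op_smul_le b.unop)).uniformContinuous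

theorem continuous_inner : Continuous fun p : PreExt φ H × PreExt φ H => inner B p.1 p.2 :=
  let F : PreExt φ H →L⋆[ℂ] PreExt φ H →L[ℂ] B :=
    LinearMap.mkContinuous₂ (form φ H) 1 fun z w => by rw [one_mul]; exact norm_inner_le z w
  (F.continuous.comp continuous_fst).clm_apply continuous_snd

end PreExt

variable [StarOrderedRing A] [StarOrderedRing B]

/-- The Hilbert `B`-module `H • B`: the completion of `(H ⊗ B) / N`, `N = {z | ⟪z, z⟫ = 0}`. (The
completion of a seminormed space already divides out the vectors of seminorm zero.) -/
abbrev Ext : Type (max v w) := UniformSpace.Completion (PreExt φ H)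

namespace Ext

open UniformSpace.Completion

variable {φ H}

theorem inner_coe (z w : PreExt φ H) :
    inner B (z : Ext φ H) (w : Ext φ H) = inner B z w :=
  (isDenseInducing_coe.prodMap isDenseInducing_coe).extend_eq
    (PreExt.continuous_inner : Continuous (Function.uncurry (inner B))) (z, w)

theorem continuous_inner : Continuous fun p : Ext φ H × Ext φ H => inner B p.1 p.2 := by
  let f : PreExt φ H →+ PreExt φ H →+ B :=
    { toFun := fun x => (PreExt.form φ H x).toAddMonoidHom
      map_zero' := by ext x; simp
      map_add' := fun x y => by ext z; simp }
  have : Continuous fun p : PreExt φ H × PreExt φ H => f p.1 p.2 := PreExt.continuous_inner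
  change Continuous (((isDenseInducing_toCompl (PreExt φ H)).prodMap
    (isDenseInducing_toCompl (PreExt φ H))).extend
      fun p : PreExt φ H × PreExt φ H => f p.1 p.2)
  exact (isDenseInducing_toCompl (PreExt φ H)).extend_Z_bilin
    (isDenseInducing_toCompl (PreExt φ H)) this

theorem continuous_inner' {X : Type*} [TopologicalSpace X] {f g : X → Ext φ H}
    (hf : Continuous f) (hg : Continuous g) : Continuous fun x => inner B (f x) (g x) :=
  continuous_inner.comp (hf.prodMk hg)

theorem continuous_op_smul {X : Type*} [TopologicalSpace X] (b : B) {f : X → Ext φ H}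
    (hf : Continuous f) : Continuous fun x => MulOpposite.op b • f x :=
  (continuous_map (f := fun z : PreExt φ H => MulOpposite.op b • z)).comp hf

theorem coe_op_smul (b : B) (z : PreExt φ H) :
    ((MulOpposite.op b • z : PreExt φ H) : Ext φ H) = MulOpposite.op b • (z : Ext φ H) :=
  coe_smul _ _

theorem norm_eq (x : Ext φ H) : ‖x‖ = √‖inner B x x‖ := by
  induction x using UniformSpace.Completion.induction_on with
  | hp =>
    exact isClosed_eq continuous_norm
      (Real.continuous_sqrt.comp (continuous_inner' continuous_id continuous_id).norm)
  | ih x => rw [norm_coe, inner_coe, PreExt.norm_def]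

instance : HilbertModule B (Ext φ H) where
  op_smul_add b x y := by
    induction x, y using induction_on₂ with
    | hp =>
      exact isClosed_eq (continuous_op_smul b (continuous_fst.add continuous_snd))
        ((continuous_op_smul b continuous_fst).add (continuous_op_smul b continuous_snd))
    | ih x y =>
      rw [← coe_add, ← coe_op_smul, ← coe_op_smul, ← coe_op_smul, ← coe_add, PreExt.op_smul_add]
  add_op_smul a b x := by
    induction x using induction_on with
    | hp =>
      exact isClosed_eq (continuous_op_smul _ continuous_id)
        ((continuous_op_smul a continuous_id).add (continuous_op_smul b continuous_id))
    | ih x =>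
      rw [← coe_op_smul, ← coe_op_smul, ← coe_op_smul, ← coe_add, PreExt.add_op_smul]
  mul_op_smul a b x := by
    induction x using induction_on with
    | hp =>
      exact isClosed_eq (continuous_op_smul _ continuous_id)
        (continuous_op_smul b (continuous_op_smul a continuous_id))
    | ih x => rw [← coe_op_smul, ← coe_op_smul, ← coe_op_smul, PreExt.mul_op_smul]
  op_smul_smul a c x := by
    induction x using induction_on with
    | hp =>
      exact isClosed_eq (continuous_op_smul a (continuous_const_smul c))
        ((continuous_op_smul a continuous_id).const_smul c)
    | ih x => rw [← coe_smul, ← coe_op_smul, ← coe_op_smul, ← coe_smul, PreExt.op_smul_smul]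
  smul_op_smul a c x := by
    induction x using induction_on with
    | hp =>
      exact isClosed_eq (continuous_op_smul _ continuous_id)
        ((continuous_op_smul a continuous_id).const_smul c)
    | ih x => rw [← coe_op_smul, ← coe_op_smul, ← coe_smul, PreExt.smul_op_smul]
  inner_add_right x y z := by
    induction x, y, z using induction_on₃ with
    | hp =>
      exact isClosed_eq (continuous_inner' (by fun_prop) (by fun_prop))
        ((continuous_inner' (by fun_prop) (by fun_prop)).add
          (continuous_inner' (by fun_prop) (by fun_prop)))
    | ih x y z => rw [← coe_add, inner_coe, inner_coe, inner_coe, PreExt.inner_add_right]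
  inner_smul_right c x y := by
    induction x, y using induction_on₂ with
    | hp =>
      have h : Continuous fun p : Ext φ H × Ext φ H => c • p.2 :=
        (continuous_const_smul c).comp continuous_snd
      have h' : Continuous fun p : Ext φ H × Ext φ H => c • inner B p.1 p.2 :=
        (continuous_const_smul c).comp continuous_inner
      exact isClosed_eq (continuous_inner' continuous_fst h) h'
    | ih x y => rw [← coe_smul, inner_coe, inner_coe, PreExt.inner_smul_right]
  inner_op_smul_right a x y := by
    induction x, y using induction_on₂ with
    | hp =>
      exact isClosed_eq (continuous_inner' continuous_fst (continuous_op_smul a continuous_snd))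
        ((continuous_inner' continuous_fst continuous_snd).mul continuous_const)
    | ih x y => rw [← coe_op_smul, inner_coe, inner_coe, PreExt.inner_op_smul_right]
  star_inner x y := by
    induction x, y using induction_on₂ with
    | hp =>
      exact isClosed_eq (continuous_inner' (by fun_prop) (by fun_prop)).star
        (continuous_inner' (by fun_prop) (by fun_prop))
    | ih x y => rw [inner_coe, inner_coe, PreExt.star_inner]
  inner_self_nonneg x := by
    induction x using induction_on with
    | hp =>
      exact CStarAlgebra.isClosed_nonneg.preimage
        (continuous_inner' continuous_id continuous_id)
    | ih x => rw [inner_coe]; exact PreExt.inner_self_nonneg x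
  eq_zero_of_inner_self x h := by
    rw [← norm_eq_zero, norm_eq, h, norm_zero, Real.sqrt_zero]
  norm_eq_sqrt := norm_eq

end Ext

variable {H}

/-- The canonical map `H → H • B`, `x ↦ x ⊗ 1`. -/
def toExt (x : H) : Ext φ H := ((PreExt.tmul φ x 1 : PreExt φ H) : Ext φ H)

end Extension

/-! ### The universal representation and the enveloping von Neumann algebra -/

section Universal

variable (A : Type u) [NonUnitalCStarAlgebra A] [PartialOrder A] [StarOrderedRing A]

/-- The states of `A`: the positive linear functionals of norm one. -/
def State : Type u :=
  {f : A →ₚ[ℂ] ℂ // ‖(⟨f.toLinearMap, map_continuous f⟩ : A →L[ℂ] ℂ)‖ = 1}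

/-- The Hilbert space of the universal representation of `A`: the Hilbert sum, over all states `f`
of `A`, of the GNS Hilbert spaces of `f`. -/
abbrev UnivSpace : Type u := lp (fun f : State A => f.1.GNS) 2

/-- The universal representation of `A`: the direct sum of the GNS representations of all states. -/
def univRep : A →⋆ₙₐ[ℂ] (UnivSpace A →L[ℂ] UnivSpace A) where
  toFun a := lp.mapCLM 2 (fun f : State A => f.1.gnsNonUnitalStarAlgHom a) (norm_nonneg a)
    (fun f => NonUnitalStarAlgHom.norm_apply_le f.1.gnsNonUnitalStarAlgHom a)
  map_smul' c a := by ext v f; simp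
  map_zero' := by ext v f; simp
  map_add' a b := by ext v f; simp
  map_mul' a b := by ext v f; simp
  map_star' a := by
    rw [ContinuousLinearMap.star_eq_adjoint, ContinuousLinearMap.eq_adjoint_iff]
    intro v w
    rw [lp.inner_eq_tsum, lp.inner_eq_tsum]
    refine tsum_congr fun f => ?_
    change inner ℂ (f.1.gnsNonUnitalStarAlgHom (star a) (v f)) (w f) =
      inner ℂ (v f) (f.1.gnsNonUnitalStarAlgHom a (w f))
    rw [map_star, ContinuousLinearMap.star_eq_adjoint, ContinuousLinearMap.adjoint_inner_left]

/-- The double commutant `π(A)''` of the image of `A` in its universal representation. -/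
def univDoubleCommutant : StarSubalgebra ℂ (UnivSpace A →L[ℂ] UnivSpace A) :=
  StarSubalgebra.centralizer ℂ (StarSubalgebra.centralizer ℂ (Set.range (univRep A)) :
    Set (UnivSpace A →L[ℂ] UnivSpace A))

instance : IsClosed (univDoubleCommutant A : Set (UnivSpace A →L[ℂ] UnivSpace A)) := by
  rw [univDoubleCommutant, StarSubalgebra.coe_centralizer]
  exact Set.isClosed_centralizer _

/-- The bidual `A⋆⋆`, realised as the enveloping von Neumann algebra `π(A)''` of `A`, where `π` is
the universal representation. -/
def Bidual : Type u := univDoubleCommutant A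

instance : CStarAlgebra (Bidual A) := inferInstanceAs (CStarAlgebra (univDoubleCommutant A))

/-- The order of the C⋆-algebra `A⋆⋆`. -/
instance : PartialOrder (Bidual A) := CStarAlgebra.spectralOrder _

instance : StarOrderedRing (Bidual A) := CStarAlgebra.spectralOrderedRing _

/-- The action of `A⋆⋆` on the Hilbert space of the universal representation. -/
def Bidual.toCLM : Bidual A →⋆ₐ[ℂ] (UnivSpace A →L[ℂ] UnivSpace A) :=
  (univDoubleCommutant A).subtype

theorem univRep_mem (a : A) : univRep A a ∈ univDoubleCommutant A := by
  rw [univDoubleCommutant, StarSubalgebra.mem_centralizer_iff]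
  intro g hg
  have hg' : star g ∈ StarSubalgebra.centralizer ℂ (Set.range (univRep A)) := star_mem hg
  exact ⟨((StarSubalgebra.mem_centralizer_iff ℂ).mp hg _ ⟨a, rfl⟩).1.symm,
    ((StarSubalgebra.mem_centralizer_iff ℂ).mp hg' _ ⟨a, rfl⟩).1.symm⟩

/-- The canonical map `A → A⋆⋆`. -/
def toBidual : A →⋆ₙₐ[ℂ] Bidual A where
  toFun a := (⟨univRep A a, univRep_mem A a⟩ : univDoubleCommutant A)
  map_smul' c a := Subtype.ext (map_smul (univRep A) c a)
  map_zero' := Subtype.ext (map_zero (univRep A))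
  map_add' a b := Subtype.ext (map_add (univRep A) a b)
  map_mul' a b := Subtype.ext (map_mul (univRep A) a b)
  map_star' a := Subtype.ext (map_star (univRep A) a)

variable (H : Type v) [NormedAddCommGroup H] [NormedSpace ℂ H] [SMul Aᵐᵒᵖ H] [HilbertModule A H]

/-- The Hilbert `A⋆⋆`-module `H • A⋆⋆`. -/
abbrev BidualExt : Type (max v u) := Ext (toBidual A) H

variable {H}

/-- The set `N_{ξ, ε, V} = {z | ‖⟪ξ - z, ξ - z⟫ v‖ < ε for all v ∈ V}`. -/
def basicNhd (ξ : BidualExt A H) (ε : ℝ) (V : Finset (UnivSpace A)) : Set (BidualExt A H) :=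
  {z | ∀ v ∈ V, ‖Bidual.toCLM A (inner (Bidual A) (ξ - z) (ξ - z)) v‖ < ε}

variable (H)

/-- The topology `T_su` on `H • A⋆⋆` generated by all the sets `N_{ξ, ε, V}` with
`ξ ∈ H • A⋆⋆`, `ε > 0` and `V` a finite set of vectors of the universal representation space. -/
@[reducible]
def topSU : TopologicalSpace (BidualExt A H) :=
  TopologicalSpace.generateFrom {U | ∃ ξ ε V, 0 < ε ∧ U = basicNhd A ξ ε V}

end Universal

end HilbertMod

end

/-!
The proof is a direct Kaplansky density argument inside the Hilbert module `E = H • A⋆⋆`.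

Write `K` for the space of the universal representation. Each `z : E` acts as a bounded operator
from `K` to the interior tensor product `E ⊗ K`, and `z ↦ ⟪v, ⟪z, z⟫ v⟫` and `z ↦ ‖⟪z, h⟫ v‖ ^ 2`
are the squared norms of that operator at `v` and of its adjoint at `h ⊗ v`. Their sum is
`starGauge`. The space `E ⊗ K` is never formed: these quantities only involve the inner product of
`E`. A bounded family converging for all these gauges converges for `T_su`
(`tendsto_inner_sub_self`), so it suffices to approximate `ξ`, `‖ξ‖ ≤ 1`, by vectors of the unit
ball of `H` in the gauges. They control adjoints as well, which is needed for the sets `N_{ζ, ε,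
V}` that contain `ξ` without being centred at it.

* *Density without norm control* (`strongStarAdherent_toExt`). The universal representation is
  nondegenerate, so the double commutant theorem holds for it
  (`sum_inner_eq_zero_of_mem_univDoubleCommutant`), and `A` is strong⋆ dense in `A⋆⋆`
  (`exists_univRep_close`). Hence `x ⊗ b` is a limit of elements `x a ⊗ 1` with `a : A`; sums and
  norm limits follow.
* *Norm control*. The transform `y ↦ 2 y (1 + ⟪y, y⟫)⁻¹` maps `H` into its unit ball
  (`exists_toExt_eq_transform`), reaches every vector of the unit ball of `E`
  (`exists_transform_eq`), and is continuous for the gauges on all of `E`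
  (`starGauge_transform_sub_le`). Continuity comes from the resolvent identity
  `transform_sub_transform`: this is the off-diagonal corner of the classical identity for `f(S) -
  f(T)`, where `f(t) = 2 t / (1 + t ^ 2)` and `S`, `T` are the self-adjoint `2 × 2` operator
  matrices on `K ⊕ (E ⊗ K)` with off-diagonal corners `y` and `η`.

So if `ξ` is the transform of `η` and `y → η` with `y` in `H`, the transforms of `y` lie in the
unit ball of `H` and converge to `ξ` (`exists_tendsto_starGauge`).
-/

noncomputable section

set_option linter.unusedSectionVars false

namespace HilbertMod

open Filter

/-! ### Nondegeneracy of the universal representation -/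

/-- Strong convergence to the identity of contractions needs to be checked on a dense set only. -/
theorem isClosed_setOf_tendsto_apply {X K : Type*} [NormedAddCommGroup K] [NormedSpace ℂ K]
    (l : Filter X) (T : X → K →L[ℂ] K) (hT : ∀ᶠ x in l, ‖T x‖ ≤ 1) :
    IsClosed {v | Tendsto (fun x => T x v) l (𝓝 v)} := by
  rw [← isSeqClosed_iff_isClosed]
  intro u v hu huv
  rw [Set.mem_ofPred_eq, Metric.tendsto_nhds]
  intro ε hε
  obtain ⟨n, hn⟩ := ((Metric.tendsto_nhds.mp huv) (ε / 3) (by positivity)).exists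
  filter_upwards [hT, Metric.tendsto_nhds.mp (hu n) (ε / 3) (by positivity)] with x hx hxn
  have h1 : dist (T x v) (T x (u n)) ≤ dist (u n) v := by
    rw [dist_eq_norm, ← map_sub, dist_comm, dist_eq_norm]
    exact (T x).le_of_opNorm_le hx _ |>.trans (by rw [one_mul])
  linarith [dist_triangle4 (T x v) (T x (u n)) (u n) v]

section Universal

variable (A : Type*) [NonUnitalCStarAlgebra A] [PartialOrder A] [StarOrderedRing A]

theorem continuous_toPreGNS (f : A →ₚ[ℂ] ℂ) : Continuous f.toPreGNS := by
  refine continuous_of_continuousAt_zero f.toPreGNS ?_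
  rw [ContinuousAt, map_zero, tendsto_zero_iff_norm_tendsto_zero]
  have h : Continuous fun a : A => √(f (star a * a)).re := by
    have := map_continuous f
    fun_prop
  have h0 := h.tendsto 0
  simp only [mul_zero, map_zero, Complex.zero_re, Real.sqrt_zero] at h0
  exact h0

theorem tendsto_gns_approximateUnit (f : A →ₚ[ℂ] ℂ) (v : f.GNS) :
    Tendsto (fun a => f.gnsNonUnitalStarAlgHom a v) (CStarAlgebra.approximateUnit A) (𝓝 v) := by
  have hl := CStarAlgebra.increasingApproximateUnit A
  have hcl := isClosed_setOf_tendsto_apply (CStarAlgebra.approximateUnit A)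
    (fun a => f.gnsNonUnitalStarAlgHom a) (hl.eventually_norm.mono fun a ha =>
      (NonUnitalStarAlgHom.norm_apply_le f.gnsNonUnitalStarAlgHom a).trans ha)
  induction v using UniformSpace.Completion.induction_on with
  | hp => exact hcl
  | ih b =>
    simp only [PositiveLinearMap.gnsNonUnitalStarAlgHom_apply_coe,
      PositiveLinearMap.leftMulMapPreGNS_apply]
    have hc := (UniformSpace.Completion.continuous_coe _).comp (continuous_toPreGNS A f)
    exact (hc.tendsto _).comp (hl.tendsto_mul_right (f.ofPreGNS b))

theorem univRep_single [DecidableEq (State A)] (a : A) (f : State A) (v : f.1.GNS) :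
    univRep A a (lp.single (E := fun f : State A => f.1.GNS) 2 f v) =
      lp.single (E := fun f : State A => f.1.GNS) 2 f (f.1.gnsNonUnitalStarAlgHom a v) := by
  ext g
  change g.1.gnsNonUnitalStarAlgHom a
    (lp.single (E := fun f : State A => f.1.GNS) 2 f v g) = _
  by_cases h : g = f
  · subst h; simp
  · simp [h]

/-- The universal representation is nondegenerate. -/
theorem tendsto_univRep_approximateUnit (v : UnivSpace A) :
    Tendsto (fun a => univRep A a v) (CStarAlgebra.approximateUnit A) (𝓝 v) := by
  classical
  have hl := CStarAlgebra.increasingApproximateUnit A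
  have hcl := isClosed_setOf_tendsto_apply (CStarAlgebra.approximateUnit A)
    (fun a => univRep A a) (hl.eventually_norm.mono fun a ha =>
      (NonUnitalStarAlgHom.norm_apply_le (univRep A) a).trans ha)
  refine hcl.mem_of_tendsto (lp.hasSum_single ENNReal.ofNat_ne_top v) (.of_forall fun s => ?_)
  simp only [Set.mem_ofPred_eq, map_sum]
  refine tendsto_finsetSum _ fun f _ => ?_
  simp only [univRep_single]
  exact ((lp.isometry_single f).continuous.tendsto _).comp (tendsto_gns_approximateUnit A f.1 (v f))

end Universal

/-! ### The double commutant theorem -/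

section DoubleCommutant

variable {K : Type*} [NormedAddCommGroup K] [InnerProductSpace ℂ K] [CompleteSpace K]
  {ι : Type*} [Fintype ι]

/-- The diagonal operator on `K ^ ι` all of whose entries are `T`. -/
def diagCLM (ι : Type*) [Fintype ι] (T : K →L[ℂ] K) :
    PiLp 2 (fun _ : ι => K) →L[ℂ] PiLp 2 (fun _ : ι => K) :=
  (PiLp.continuousLinearEquiv 2 ℂ fun _ : ι => K).symm.toContinuousLinearMap ∘L
    ContinuousLinearMap.pi fun i => T ∘L PiLp.proj 2 (fun _ : ι => K) i

@[simp]
theorem diagCLM_apply (T : K →L[ℂ] K) (v : PiLp 2 fun _ : ι => K) (i : ι) :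
    diagCLM ι T v i = T (v i) := rfl

theorem inner_diagCLM_left (T : K →L[ℂ] K) (v w : PiLp 2 fun _ : ι => K) :
    inner ℂ (diagCLM ι T v) w = inner ℂ v (diagCLM ι (star T) w) := by
  simp [PiLp.inner_apply, ContinuousLinearMap.star_eq_adjoint,
    ContinuousLinearMap.adjoint_inner_right]

/-- An operator on `K ^ ι` commuting with the diagonal operators of `S` commutes with those of the
double commutant of `S`, because its matrix entries lie in the commutant of `S`. -/
theorem commute_diagCLM_of_mem_centralizer [DecidableEq ι] {S : Set (K →L[ℂ] K)}
    (hS : ∀ T ∈ S, star T ∈ S)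
    {P : PiLp 2 (fun _ : ι => K) →L[ℂ] PiLp 2 (fun _ : ι => K)}
    (hP : ∀ T ∈ S, ∀ v, P (diagCLM ι T v) = diagCLM ι T (P v)) {b : K →L[ℂ] K}
    (hb : b ∈ StarSubalgebra.centralizer ℂ (StarSubalgebra.centralizer ℂ S : Set (K →L[ℂ] K)))
    (v : PiLp 2 fun _ : ι => K) : P (diagCLM ι b v) = diagCLM ι b (P v) := by
  let incl (j : ι) : K →L[ℂ] PiLp 2 (fun _ : ι => K) :=
    (PiLp.continuousLinearEquiv 2 ℂ fun _ : ι => K).symm.toContinuousLinearMap ∘L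
      ContinuousLinearMap.single ℂ (fun _ : ι => K) j
  have hincl (T : K →L[ℂ] K) (j : ι) (w : K) : incl j (T w) = diagCLM ι T (incl j w) := by
    ext i
    by_cases h : i = j
    · subst h; simp [incl]
    · simp [incl, h]
  have hsum (w : PiLp 2 fun _ : ι => K) : w = ∑ j, incl j (w j) := by
    ext i
    simp [incl, Finset.sum_apply, Pi.single_apply]
  let E (i j : ι) : K →L[ℂ] K := PiLp.proj 2 (fun _ : ι => K) i ∘L P ∘L incl j
  have hE (i j : ι) : E i j ∈ StarSubalgebra.centralizer ℂ S := by
    have h (T : K →L[ℂ] K) (hT : T ∈ S) : T * E i j = E i j * T := by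
      ext w
      change T (P (incl j w) i) = P (incl j (T w)) i
      rw [hincl, hP T hT, diagCLM_apply]
    rw [StarSubalgebra.mem_centralizer_iff]
    exact fun T hT => ⟨h T hT, h _ (hS T hT)⟩
  have hEb (i j : ι) (w : K) : E i j (b w) = b (E i j w) :=
    congr($(((StarSubalgebra.mem_centralizer_iff ℂ).mp hb _ (hE i j)).1) w)
  ext i
  rw [diagCLM_apply, hsum (diagCLM ι b v)]
  conv_rhs => rw [hsum v]
  simp only [map_sum, WithLp.ofLp_sum, Finset.sum_apply, diagCLM_apply]
  exact Finset.sum_congr rfl fun j _ => hEb i j (v j)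

variable {A : Type*} [NonUnitalCStarAlgebra A] [PartialOrder A] [StarOrderedRing A]

/-- The double commutant theorem in dual form: a functional `∑ i, ⟪u i, · (v i)⟫` on `A⋆⋆` that
vanishes on `A` is zero. Indeed the closure `M` of `{(a (v i))ᵢ | a ∈ A}` reduces the diagonal
operators of `A`, so its projection commutes with `b`; by nondegeneracy `v ∈ M`, hence `(b (v i))ᵢ
∈ M`. -/
theorem sum_inner_eq_zero_of_mem_univDoubleCommutant (u v : ι → UnivSpace A)
    (h : ∀ a, ∑ i, inner ℂ (u i) (univRep A a (v i)) = 0)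
    {b : UnivSpace A →L[ℂ] UnivSpace A} (hb : b ∈ univDoubleCommutant A) :
    ∑ i, inner ℂ (u i) (b (v i)) = 0 := by
  classical
  let V : PiLp 2 (fun _ : ι => UnivSpace A) := WithLp.toLp 2 v
  let U : PiLp 2 (fun _ : ι => UnivSpace A) := WithLp.toLp 2 u
  let M₀ : Submodule ℂ (PiLp 2 (fun _ : ι => UnivSpace A)) :=
    { carrier := Set.range fun a => diagCLM ι (univRep A a) V
      add_mem' := by
        rintro _ _ ⟨a, rfl⟩ ⟨b, rfl⟩
        exact ⟨a + b, by ext i; simp⟩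
      zero_mem' := ⟨0, by ext i; simp⟩
      smul_mem' := by
        rintro c _ ⟨a, rfl⟩
        exact ⟨c • a, by ext i; simp⟩ }
  let M := M₀.topologicalClosure
  have : CompleteSpace M := M₀.isClosed_topologicalClosure.completeSpace_coe
  have hM (a : A) (x) (hx : x ∈ M) : diagCLM ι (univRep A a) x ∈ M := by
    refine map_mem_closure (diagCLM ι (univRep A a)).continuous hx ?_
    rintro _ ⟨c, rfl⟩
    exact ⟨a * c, by ext i; simp⟩
  have hM' (a : A) (x) (hx : x ∈ Mᗮ) : diagCLM ι (univRep A a) x ∈ Mᗮ := by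
    rw [Submodule.mem_orthogonal] at hx ⊢
    intro y hy
    have := hx _ (hM (star a) y hy)
    rwa [inner_diagCLM_left, map_star, star_star] at this
  have hP : ∀ T ∈ Set.range (univRep A), ∀ x,
      M.starProjection (diagCLM ι T x) = diagCLM ι T (M.starProjection x) := by
    rintro _ ⟨a, rfl⟩ x
    refine Submodule.eq_starProjection_of_mem_of_inner_eq_zero
      (hM a _ (M.starProjection_apply_mem x)) fun w hw => ?_
    rw [← map_sub]
    exact (Submodule.mem_orthogonal' _ _).mp
      (hM' a _ (M.sub_starProjection_mem_orthogonal x)) w hw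
  have hVM : V ∈ M := by
    have ht : Tendsto (fun a => diagCLM ι (univRep A a) V) (CStarAlgebra.approximateUnit A)
        (𝓝 V) :=
      ((PiLp.continuous_toLp 2 _).tendsto _).comp
        (tendsto_pi_nhds.mpr fun i => tendsto_univRep_approximateUnit A (v i))
    exact mem_closure_of_tendsto ht (.of_forall fun a => ⟨a, rfl⟩)
  have hbV : diagCLM ι b V ∈ M := by
    have h1 := commute_diagCLM_of_mem_centralizer (ι := ι)
      (by rintro _ ⟨a, rfl⟩; exact ⟨star a, map_star _ _⟩) hP hb V
    rw [Submodule.starProjection_eq_self_iff.mpr hVM] at h1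
    exact Submodule.starProjection_eq_self_iff.mp h1
  have hU : M ≤ (Submodule.span ℂ {U})ᗮ := by
    refine Submodule.topologicalClosure_minimal _ ?_ (Submodule.isClosed_orthogonal _)
    rintro _ ⟨a, rfl⟩
    rw [Submodule.mem_orthogonal_singleton_iff_inner_right, PiLp.inner_apply]
    exact h a
  have := Submodule.mem_orthogonal_singleton_iff_inner_right.mp (hU hbV)
  rwa [PiLp.inner_apply] at this

/-- A vector `x` of a complex Hilbert space lies in the closure of a real subspace `M` as soon as it
is orthogonal, for the real inner product, to the vectors that are orthogonal to `M`. -/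
theorem mem_closure_of_re_inner_eq_zero {G : Type*} [NormedAddCommGroup G] [InnerProductSpace ℂ G]
    [CompleteSpace G] (M : AddSubgroup G) (hM : ∀ (c : ℝ), ∀ x ∈ M, (c : ℂ) • x ∈ M) {x : G}
    (hx : ∀ u : G, (∀ y ∈ M, (inner ℂ u y).re = 0) → (inner ℂ u x).re = 0) :
    x ∈ closure (M : Set G) := by
  let _ : InnerProductSpace ℝ G := InnerProductSpace.complexToReal
  let N : @Submodule ℝ G _ _ InnerProductSpace.toNormedSpace.toModule :=
    { M with smul_mem' := fun c x hx => by rw [← Complex.coe_smul]; exact hM c x hx }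
  have h : x ∈ N.topologicalClosure := by
    rw [← Submodule.orthogonal_orthogonal_eq_closure, Submodule.mem_orthogonal]
    exact fun u hu => hx u fun y hy => (Submodule.mem_orthogonal' _ _).mp hu y hy
  exact h

/-- `A` is strong⋆ dense in `A⋆⋆`. -/
theorem exists_univRep_close (v : ι → UnivSpace A) {b : UnivSpace A →L[ℂ] UnivSpace A}
    (hb : b ∈ univDoubleCommutant A) {ε : ℝ} (hε : 0 < ε) :
    ∃ a, ∀ i, ‖(univRep A a - b) (v i)‖ < ε ∧ ‖star (univRep A a - b) (v i)‖ < ε := by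
  let F (T : UnivSpace A →L[ℂ] UnivSpace A) : PiLp 2 (fun _ : ι ⊕ ι => UnivSpace A) :=
    WithLp.toLp 2 (Sum.elim (fun i => T (v i)) (fun i => star T (v i)))
  have hadd (S T) : F (S + T) = F S + F T := by
    ext i; cases i <;> simp [F]
  -- the adjoint is only conjugate linear, so the pairs `(a v, a⋆ v)` form a real subspace
  let M : AddSubgroup (PiLp 2 (fun _ : ι ⊕ ι => UnivSpace A)) :=
    ((AddMonoidHom.mk' F hadd).comp (univRep A : A →+ UnivSpace A →L[ℂ] UnivSpace A)).range
  have key : F b ∈ closure (M : Set (PiLp 2 (fun _ : ι ⊕ ι => UnivSpace A))) := by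
    refine mem_closure_of_re_inner_eq_zero M ?_ fun U hU => ?_
    · rintro c _ ⟨a, rfl⟩
      refine ⟨(c : ℂ) • a, ?_⟩
      change F (univRep A ((c : ℂ) • a)) = (c : ℂ) • F (univRep A a)
      have hc : star (c : ℂ) = c := Complex.conj_ofReal c
      generalize (c : ℂ) = c at hc
      rw [map_smul]
      ext i
      cases i <;> simp [F, hc]
    have hF (T : UnivSpace A →L[ℂ] UnivSpace A) : (inner ℂ U (F T)).re =
        (∑ i : ι ⊕ ι, inner ℂ (Sum.elim (fun i => U (.inl i)) v i)
          (T (Sum.elim v (fun i => U (.inr i)) i))).re := by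
      rw [PiLp.inner_apply]
      simp only [Fintype.sum_sum_type, Complex.add_re, Complex.re_sum, F, Sum.elim_inl,
        Sum.elim_inr, ContinuousLinearMap.star_eq_adjoint,
        ContinuousLinearMap.adjoint_inner_right]
      congr 1
      exact Finset.sum_congr rfl fun i _ => by
        rw [← inner_conj_symm, Complex.conj_re]
    have hre (a : A) : (∑ i : ι ⊕ ι, inner ℂ (Sum.elim (fun i => U (.inl i)) v i)
        (univRep A a (Sum.elim v (fun i => U (.inr i)) i))).re = 0 := by
      rw [← hF]
      exact hU _ ⟨a, rfl⟩
    rw [hF, sum_inner_eq_zero_of_mem_univDoubleCommutant _ _ (fun a => ?_) hb, Complex.zero_re]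
    refine Complex.ext (hre a) ?_
    have h := hre (Complex.I • a)
    simp only [map_smul, smul_apply] at h
    rw [Finset.sum_congr rfl fun i _ => _root_.inner_smul_right _ _ _, ← Finset.mul_sum,
      Complex.I_mul_re, neg_eq_zero] at h
    exact h
  obtain ⟨_, ⟨a, rfl⟩, ha⟩ := Metric.mem_closure_iff.mp key ε hε
  have hle (i : ι ⊕ ι) : ‖(F (univRep A a) - F b) i‖ < ε := by
    refine (PiLp.norm_apply_le _ i).trans_lt ?_
    rw [dist_comm, dist_eq_norm] at ha
    exact ha
  refine ⟨a, fun i => ⟨hle (.inl i), ?_⟩⟩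
  have := hle (.inr i)
  rw [star_sub]
  exact this

end DoubleCommutant

/-! ### Calculus in Hilbert modules -/

namespace HilbertModule

section NonUnital

variable {A H : Type*} [NonUnitalCStarAlgebra A] [PartialOrder A]
  [NormedAddCommGroup H] [NormedSpace ℂ H] [SMul Aᵐᵒᵖ H] [HilbertModule A H]

theorem inner_sub_right (x y z : H) : inner A x (y - z) = inner A x y - inner A x z :=
  map_sub (AddMonoidHom.mk' (fun y => inner A x y) (inner_add_right x)) y z

theorem inner_sub_left (x y z : H) : inner A (x - y) z = inner A x z - inner A y z :=
  map_sub (AddMonoidHom.mk' (fun y => inner A y z) (fun x y => inner_add_left x y z)) x y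

theorem inner_neg_left (x y : H) : inner A (-x) y = -inner A x y :=
  map_neg (AddMonoidHom.mk' (fun x => inner A x y) (fun a b => inner_add_left a b y)) x

theorem op_smul_sub (a : A) (x y : H) :
    MulOpposite.op a • (x - y) = MulOpposite.op a • x - MulOpposite.op a • y :=
  map_sub (AddMonoidHom.mk' (fun x : H => MulOpposite.op a • x) (op_smul_add a)) x y

theorem sub_op_smul (a b : A) (x : H) :
    MulOpposite.op (a - b) • x = MulOpposite.op a • x - MulOpposite.op b • x :=
  map_sub (AddMonoidHom.mk' (fun a : A => MulOpposite.op a • x) (fun a b => add_op_smul a b x)) a b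

theorem norm_sq_eq (x : H) : ‖x‖ ^ 2 = ‖inner A x x‖ := by
  rw [norm_eq_sqrt (A := A), Real.sq_sqrt (norm_nonneg _)]

/-- The Cauchy–Schwarz inequality in a Hilbert module. -/
theorem star_inner_mul_inner_le [StarOrderedRing A] (h x : H) :
    star (inner A h x) * inner A h x ≤ (‖h‖ ^ 2) • inner A x x := by
  set c := inner A h x with hc
  have hcx : inner A x h = star c := by rw [hc, star_inner]
  rcases eq_or_ne h 0 with rfl | hh
  · have : c = 0 := by
      rw [hc, ← sub_self (0 : H), inner_sub_left, sub_self]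
    simp [this]
  set t : ℝ := ‖h‖ ^ 2 with ht
  have htpos : 0 < t := by positivity
  -- expand `⟪t x - h c, t x - h c⟫ ≥ 0`
  have h0 : 0 ≤ inner A ((t : ℂ) • x - MulOpposite.op c • h)
      ((t : ℂ) • x - MulOpposite.op c • h) := inner_self_nonneg _
  have hexp : inner A ((t : ℂ) • x - MulOpposite.op c • h)
      ((t : ℂ) • x - MulOpposite.op c • h) =
      ((t ^ 2 : ℝ) • inner A x x - (2 * t) • (star c * c)) + star c * inner A h h * c := by
    simp only [inner_sub_left, inner_sub_right, inner_smul_left, inner_smul_right,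
      inner_op_smul_left, inner_op_smul_right, hcx, ← hc, Complex.star_def, Complex.conj_ofReal,
      smul_mul_assoc, smul_smul, mul_assoc, smul_sub, sub_mul]
    simp only [← Complex.ofReal_mul, Complex.coe_smul]
    rw [two_mul, add_smul, pow_two]
    abel
  have hle : star c * inner A h h * c ≤ t • (star c * c) := by
    refine (CStarAlgebra.star_left_conjugate_le_norm_smul
      (hb := IsSelfAdjoint.of_nonneg (inner_self_nonneg h))).trans_eq ?_
    rw [← norm_sq_eq]
  rw [hexp] at h0
  have h1 : t • (star c * c) ≤ (t ^ 2) • inner A x x := by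
    have h2 : 0 ≤ ((t ^ 2 : ℝ) • inner A x x - (2 * t) • (star c * c)) + t • (star c * c) :=
      h0.trans (by gcongr)
    rw [two_mul, add_smul] at h2
    rw [← sub_nonneg]
    convert h2 using 1
    abel
  have h3 := smul_le_smul_of_nonneg_left h1 (inv_nonneg.mpr htpos.le)
  rwa [smul_smul, smul_smul, inv_mul_cancel₀ htpos.ne', one_smul, pow_two, ← mul_assoc,
    inv_mul_cancel₀ htpos.ne', one_mul] at h3

end NonUnital

section Unital

variable {B E : Type*} [CStarAlgebra B] [PartialOrder B]
  [NormedAddCommGroup E] [NormedSpace ℂ E] [SMul Bᵐᵒᵖ E] [HilbertModule B E]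

theorem op_one_smul (x : E) : MulOpposite.op (1 : B) • x = x := by
  rw [← sub_eq_zero]
  refine eq_zero_of_inner_self (A := B) _ ?_
  simp only [inner_sub_left, inner_sub_right, inner_op_smul_left, inner_op_smul_right, star_one,
    one_mul, mul_one, sub_self]

/-- The operator `z ↦ z - y m ⟪y, z⟫`. When `m = (1 + ⟪y, y⟫)⁻¹` it is the inverse of
`1 + y ⟪y, ·⟫`. -/
def resolvent (y : E) (m : B) (z : E) : E := z - MulOpposite.op (m * inner B y z) • y

theorem inner_resolvent {y : E} {m : B} (hm : star m = m) (z w : E) :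
    inner B (resolvent y m z) w = inner B z (resolvent y m w) := by
  simp only [resolvent, inner_sub_left, inner_sub_right, inner_op_smul_left, inner_op_smul_right,
    star_mul, hm, star_inner, mul_assoc]

/-- The resolvent identity for the transform `y ↦ 2 y (1 + ⟪y, y⟫)⁻¹`: the difference of two
values, at `y` and `η`, is expressed through terms linear in `y - η`, with coefficients bounded
independently of `y`. -/
theorem transform_sub_transform {y η : E} {m n : B} (hm : m * (1 + inner B y y) = 1)
    (hn : (1 + inner B η η) * n = 1) :
    (2 : ℂ) • MulOpposite.op m • y - (2 : ℂ) • MulOpposite.op n • η =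
      (2 : ℂ) • MulOpposite.op n • resolvent y m (y - η) +
        MulOpposite.op (inner B (η - y) ((2 : ℂ) • MulOpposite.op n • η)) •
          MulOpposite.op m • y := by
  have h1 : n - m * (inner B y y - inner B y η) * n +
      m * ((inner B η η - inner B y η) * n) = m := by
    calc _ = n - (m * (1 + inner B y y)) * n + m * ((1 + inner B η η) * n) := by noncomm_ring
      _ = m := by rw [hm, hn]; noncomm_ring
  simp only [resolvent, op_smul_sub, inner_sub_left, inner_sub_right, inner_smul_right,
    inner_op_smul_right, ← mul_op_smul]
  have h2 : m = n - m * (inner B y y - inner B y η) * n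
    + m * ((inner B η η - inner B y η) * n) := h1.symm
  conv_lhs => rw [h2]
  simp only [smul_add, smul_sub, add_op_smul, sub_op_smul, sub_mul, mul_sub, mul_smul_comm,
    smul_op_smul, mul_assoc]
  abel

theorem star_eq_of_mul_eq_one {y : E} {m : B} (hm : m * (1 + inner B y y) = 1) :
    star m = m := by
  have h := congr(star $hm)
  rw [star_mul, star_add, star_one, star_inner] at h
  exact (left_inv_eq_right_inv hm h).symm

variable [StarOrderedRing B]

theorem inner_resolvent_self_le {y : E} {m : B} (hm : m * (1 + inner B y y) = 1)
    (hm' : (1 + inner B y y) * m = 1) (z : E) :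
    inner B (resolvent y m z) (resolvent y m z) ≤ inner B z z := by
  have hs := star_eq_of_mul_eq_one hm
  have ha : 0 ≤ inner B y y := inner_self_nonneg y
  set a := inner B y y with had
  have h1 : m + m - m * a * m = star m * (2 + a) * m := by
    calc m + m - m * a * m = m * ((1 + a) * m) + (m * (1 + a)) * m - m * a * m := by
          rw [hm, hm', mul_one, one_mul]
      _ = _ := by rw [hs]; noncomm_ring
  have h2 : inner B z z - inner B (resolvent y m z) (resolvent y m z) =
      star (inner B y z) * (star m * (2 + a) * m) * inner B y z := by
    rw [← h1]
    simp only [resolvent, inner_sub_left, inner_sub_right, inner_op_smul_left, inner_op_smul_right,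
      star_mul, hs, ← had, star_inner y z]
    noncomm_ring
  rw [← sub_nonneg, h2]
  have h3 : (0 : B) ≤ 2 + a := add_nonneg zero_le_two ha
  exact star_left_conjugate_nonneg (star_left_conjugate_nonneg h3 m) _

theorem norm_le_one_of_mul_eq_one {y : E} {m : B} (hm : m * (1 + inner B y y) = 1)
    (hm' : (1 + inner B y y) * m = 1) : ‖m‖ ≤ 1 := by
  have hs := star_eq_of_mul_eq_one hm
  have ha : 0 ≤ inner B y y := inner_self_nonneg y
  set a := inner B y y with had
  have h1 : 1 - star m * m = star m * (a + a + star a * a) * m := by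
    rw [(IsSelfAdjoint.of_nonneg ha).star_eq, hs]
    calc 1 - m * m = (m * (1 + a)) * ((1 + a) * m) - m * m := by rw [hm, hm', mul_one]
      _ = _ := by noncomm_ring
  have h2 : star m * m ≤ 1 := by
    rw [← sub_nonneg, h1]
    exact star_left_conjugate_nonneg
      (add_nonneg (add_nonneg ha ha) (star_mul_self_nonneg a)) m
  have h3 := (CStarAlgebra.norm_le_one_iff_of_nonneg _ (star_mul_self_nonneg m)).mpr h2
  rw [CStarRing.norm_star_mul_self] at h3
  nlinarith [norm_nonneg m]

end Unital

end HilbertModule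

/-! ### The strong⋆ gauges -/

section Gauge

open HilbertModule

variable {B E K : Type*} [CStarAlgebra B] [PartialOrder B] [StarOrderedRing B]
  [NormedAddCommGroup E] [NormedSpace ℂ E] [SMul Bᵐᵒᵖ E] [HilbertModule B E]
  [NormedAddCommGroup K] [InnerProductSpace ℂ K] [CompleteSpace K]
  (π : B →⋆ₐ[ℂ] (K →L[ℂ] K))

theorem re_inner_apply_nonneg {b : B} (hb : 0 ≤ b) (v : K) : 0 ≤ (inner ℂ v (π b v)).re := by
  obtain ⟨c, rfl⟩ := exists_eq_star_mul_self hb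
  rw [map_mul, map_star, ContinuousLinearMap.star_eq_adjoint]
  change 0 ≤ (inner ℂ v (ContinuousLinearMap.adjoint (π c) (π c v))).re
  rw [ContinuousLinearMap.adjoint_inner_right]
  exact _root_.inner_self_nonneg (𝕜 := ℂ)

theorem re_inner_apply_mono {b c : B} (hbc : b ≤ c) (v : K) :
    (inner ℂ v (π b v)).re ≤ (inner ℂ v (π c v)).re := by
  have := re_inner_apply_nonneg π (sub_nonneg.mpr hbc) v
  rw [map_sub, sub_apply, _root_.inner_sub_right, Complex.sub_re] at this
  linarith

theorem re_inner_star_mul_apply (c : B) (v : K) :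
    (inner ℂ v (π (star c * c) v)).re = ‖π c v‖ ^ 2 := by
  rw [map_mul, map_star, ContinuousLinearMap.star_eq_adjoint]
  change (inner ℂ v (ContinuousLinearMap.adjoint (π c) (π c v))).re = _
  rw [ContinuousLinearMap.adjoint_inner_right, inner_self_eq_norm_sq_to_K (𝕜 := ℂ)]
  norm_cast

/-- The square `⟪v, ⟪z, z⟫ v⟫` of the norm of `z ⊗ v` in the interior tensor product of `E` and the
Hilbert space `K`. -/
def vecGauge (v : K) (z : E) : ℝ := (inner ℂ v (π (inner B z z) v)).re

/-- The squared seminorms defining the strong⋆ topology. A vector `z` of `E` acts as the operator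
`w ↦ z ⊗ w` from `K` to the interior tensor product `E ⊗ K`; this is the squared norm of that
operator at `v` plus the squared norm of its adjoint at `h ⊗ v`. -/
def starGauge (h : E) (v : K) (z : E) : ℝ := vecGauge π v z + ‖π (inner B z h) v‖ ^ 2

theorem vecGauge_nonneg (v : K) (z : E) : 0 ≤ vecGauge π v z :=
  re_inner_apply_nonneg π (inner_self_nonneg z) v

theorem starGauge_nonneg (h : E) (v : K) (z : E) : 0 ≤ starGauge π h v z :=
  add_nonneg (vecGauge_nonneg π v z) (sq_nonneg _)

theorem vecGauge_le_starGauge (h : E) (v : K) (z : E) : vecGauge π v z ≤ starGauge π h v z :=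
  le_add_of_nonneg_right (sq_nonneg _)

theorem sq_norm_le_starGauge (h : E) (v : K) (z : E) :
    ‖π (inner B z h) v‖ ^ 2 ≤ starGauge π h v z :=
  le_add_of_nonneg_left (vecGauge_nonneg π v z)

theorem sq_norm_inner_apply_le (h z : E) (v : K) :
    ‖π (inner B h z) v‖ ^ 2 ≤ ‖h‖ ^ 2 * vecGauge π v z := by
  rw [← re_inner_star_mul_apply]
  refine (re_inner_apply_mono π (star_inner_mul_inner_le h z) v).trans_eq ?_
  rw [← Complex.coe_smul, map_smul, smul_apply, _root_.inner_smul_right,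
    Complex.re_ofReal_mul, vecGauge]

theorem vecGauge_op_smul (b : B) (v : K) (z : E) :
    vecGauge π v (MulOpposite.op b • z) = vecGauge π (π b v) z := by
  rw [vecGauge, vecGauge, inner_op_smul_left, inner_op_smul_right, map_mul, map_mul, map_star,
    ContinuousLinearMap.star_eq_adjoint]
  change (inner ℂ v (ContinuousLinearMap.adjoint (π b) _)).re = _
  rw [ContinuousLinearMap.adjoint_inner_right]
  rfl

theorem vecGauge_smul (c : ℂ) (v : K) (z : E) :
    vecGauge π v (c • z) = ‖c‖ ^ 2 * vecGauge π v z := by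
  rw [vecGauge, vecGauge, HilbertModule.inner_smul_left, HilbertModule.inner_smul_right, smul_smul,
    map_smul, smul_apply, _root_.inner_smul_right, Complex.star_def, Complex.conj_mul',
    ← Complex.ofReal_pow, Complex.re_ofReal_mul]

theorem vecGauge_add_le (v : K) (z w : E) :
    vecGauge π v (z + w) ≤ 2 * vecGauge π v z + 2 * vecGauge π v w := by
  have h := vecGauge_nonneg π v (z - w)
  have : vecGauge π v (z + w) + vecGauge π v (z - w) =
      2 * vecGauge π v z + 2 * vecGauge π v w := by
    simp only [vecGauge, HilbertModule.inner_add_left, HilbertModule.inner_sub_left,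
      HilbertModule.inner_add_right, HilbertModule.inner_sub_right, map_add, map_sub,
      add_apply, sub_apply,
      _root_.inner_add_right, _root_.inner_sub_right, Complex.add_re, Complex.sub_re]
    ring
  linarith

theorem vecGauge_le (v : K) (z : E) : vecGauge π v z ≤ ‖z‖ ^ 2 * ‖v‖ ^ 2 := by
  calc vecGauge π v z ≤ ‖v‖ * ‖π (inner B z z) v‖ :=
        (Complex.re_le_norm _).trans (norm_inner_le_norm _ _)
    _ ≤ ‖v‖ * (‖inner B z z‖ * ‖v‖) := by
      gcongr
      exact (π (inner B z z)).le_of_opNorm_le (NonUnitalStarAlgHom.norm_apply_le π _) v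
    _ = _ := by rw [← norm_sq_eq]; ring

theorem sq_norm_add_le {V : Type*} [SeminormedAddCommGroup V] (x y : V) :
    ‖x + y‖ ^ 2 ≤ 2 * ‖x‖ ^ 2 + 2 * ‖y‖ ^ 2 := by
  nlinarith [norm_add_le x y, norm_nonneg (x + y), sq_nonneg (‖x‖ - ‖y‖)]

theorem starGauge_add_le (h : E) (v : K) (z w : E) :
    starGauge π h v (z + w) ≤ 2 * starGauge π h v z + 2 * starGauge π h v w := by
  have h1 := vecGauge_add_le π v z w
  have h2 := sq_norm_add_le (π (inner B z h) v) (π (inner B w h) v)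
  rw [← add_apply, ← map_add, ← HilbertModule.inner_add_left] at h2
  simp only [starGauge]
  linarith

theorem starGauge_le (h : E) (v : K) (z : E) :
    starGauge π h v z ≤ (‖v‖ ^ 2 + vecGauge π v h) * ‖z‖ ^ 2 := by
  rw [starGauge]
  linarith [vecGauge_le π v z, sq_norm_inner_apply_le π z h v]

/-- The transform `y ↦ 2 y (1 + ⟪y, y⟫)⁻¹` is strong⋆ continuous: the bound is uniform in `y`, and
the gauges on the right depend only on `η`, `h` and `v`. -/
theorem starGauge_transform_sub_le {y η : E} {m n : B}
    (hm : m * (1 + inner B y y) = 1) (hm' : (1 + inner B y y) * m = 1)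
    (hn : n * (1 + inner B η η) = 1) (hn' : (1 + inner B η η) * n = 1) {x ξ : E}
    (hx : x = (2 : ℂ) • MulOpposite.op m • y) (hξ : ξ = (2 : ℂ) • MulOpposite.op n • η)
    (hx1 : ‖x‖ ≤ 1) (h : E) (v : K) :
    starGauge π h v (x - ξ) ≤ 8 * (starGauge π 0 (π n v) (y - η) + starGauge π ξ v (y - η) +
      starGauge π (resolvent η n h) v (y - η) + starGauge π 0 (π (inner B ξ h) v) (y - η)) := by
  have hms := star_eq_of_mul_eq_one hm
  have hns := star_eq_of_mul_eq_one hn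
  have hnorm := norm_le_one_of_mul_eq_one hm hm'
  have hxm : MulOpposite.op m • y = (1 / 2 : ℂ) • x := by
    rw [hx, smul_smul]; norm_num
  have hξn : MulOpposite.op n • η = (1 / 2 : ℂ) • ξ := by
    rw [hξ, smul_smul]; norm_num
  -- the value of `x - ξ` at `v`
  have h1 : vecGauge π v (x - ξ) ≤ 8 * vecGauge π (π n v) (y - η) +
      1 / 2 * ‖π (inner B (y - η) ξ) v‖ ^ 2 := by
    have e : x - ξ = (2 : ℂ) • MulOpposite.op n • resolvent y m (y - η) +
        MulOpposite.op (inner B (η - y) ξ) • (1 / 2 : ℂ) • x := by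
      rw [← hxm, hx, hξ]
      exact transform_sub_transform hm hn'
    have e1 : vecGauge π v ((2 : ℂ) • MulOpposite.op n • resolvent y m (y - η)) ≤
        4 * vecGauge π (π n v) (y - η) := by
      rw [vecGauge_smul, vecGauge_op_smul]
      have : vecGauge π (π n v) (resolvent y m (y - η)) ≤ vecGauge π (π n v) (y - η) :=
        re_inner_apply_mono π (inner_resolvent_self_le hm hm' _) _
      norm_num
      linarith
    have e2 : vecGauge π v (MulOpposite.op (inner B (η - y) ξ) • (1 / 2 : ℂ) • x) ≤
        1 / 4 * ‖π (inner B (y - η) ξ) v‖ ^ 2 := by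
      rw [vecGauge_op_smul, vecGauge_smul, ← neg_sub y η, HilbertModule.inner_neg_left, map_neg,
        neg_apply, ← norm_neg]
      have := vecGauge_le π (-(π (inner B (y - η) ξ) v)) x
      have hx2 : ‖x‖ ^ 2 ≤ 1 := pow_le_one₀ (norm_nonneg _) hx1
      norm_num at this ⊢
      nlinarith [sq_nonneg ‖π (inner B (y - η) ξ) v‖]
    have := vecGauge_add_le π v ((2 : ℂ) • MulOpposite.op n • resolvent y m (y - η))
      (MulOpposite.op (inner B (η - y) ξ) • (1 / 2 : ℂ) • x)
    rw [← e] at this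
    linarith
  -- the value of its adjoint at `h ⊗ v`; here the resolvent identity is used with the roles of
  -- `y` and `η` exchanged, so that the resolvent falls on the fixed vector `h`
  have h2 : ‖π (inner B (x - ξ) h) v‖ ^ 2 ≤
      8 * ‖π (inner B (y - η) (resolvent η n h)) v‖ ^ 2 +
        1 / 2 * vecGauge π (π (inner B ξ h) v) (y - η) := by
    have e : ξ - x = (2 : ℂ) • MulOpposite.op m • resolvent η n (η - y) +
        MulOpposite.op (inner B (y - η) x) • (1 / 2 : ℂ) • ξ := by
      rw [← hξn, hx, hξ]
      exact transform_sub_transform hn hm'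
    have e1 : inner B (ξ - x) h = (2 : ℂ) • (m * inner B (η - y) (resolvent η n h)) +
        (1 / 2 : ℂ) • (inner B x (y - η) * inner B ξ h) := by
      rw [e, HilbertModule.inner_add_left, HilbertModule.inner_smul_left, inner_op_smul_left,
        inner_op_smul_left, HilbertModule.inner_smul_left, inner_resolvent hns, hms, star_inner]
      simp
    have e2 : ‖π ((2 : ℂ) • (m * inner B (η - y) (resolvent η n h))) v‖ ^ 2 ≤
        4 * ‖π (inner B (y - η) (resolvent η n h)) v‖ ^ 2 := by
      rw [← neg_sub y η, HilbertModule.inner_neg_left, map_smul, map_mul, map_neg, smul_apply,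
        norm_smul, mul_pow]
      change _ * ‖π m ((-(π (inner B (y - η) (resolvent η n h)))) v)‖ ^ 2 ≤ _
      have h3 := (π m).le_of_opNorm_le ((NonUnitalStarAlgHom.norm_apply_le π m).trans hnorm)
        ((-(π (inner B (y - η) (resolvent η n h)))) v)
      rw [one_mul, neg_apply, norm_neg] at h3
      norm_num
      gcongr
      simpa using h3
    have e3 : ‖π ((1 / 2 : ℂ) • (inner B x (y - η) * inner B ξ h)) v‖ ^ 2 ≤
        1 / 4 * vecGauge π (π (inner B ξ h) v) (y - η) := by
      rw [map_smul, map_mul, smul_apply, norm_smul, mul_pow]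
      change _ * ‖π (inner B x (y - η)) (π (inner B ξ h) v)‖ ^ 2 ≤ _
      have h3 := sq_norm_inner_apply_le π x (y - η) (π (inner B ξ h) v)
      have hx2 : ‖x‖ ^ 2 ≤ 1 := pow_le_one₀ (norm_nonneg _) hx1
      have h4 := vecGauge_nonneg π (π (inner B ξ h) v) (y - η)
      norm_num
      nlinarith
    have := sq_norm_add_le (π ((2 : ℂ) • (m * inner B (η - y) (resolvent η n h))) v)
      (π ((1 / 2 : ℂ) • (inner B x (y - η) * inner B ξ h)) v)
    rw [← add_apply, ← map_add, ← e1, ← neg_sub x ξ, HilbertModule.inner_neg_left, map_neg,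
      neg_apply, norm_neg] at this
    linarith
  have g1 := vecGauge_le_starGauge π 0 (π n v) (y - η)
  have g2 := sq_norm_le_starGauge π ξ v (y - η)
  have g3 := sq_norm_le_starGauge π (resolvent η n h) v (y - η)
  have g4 := vecGauge_le_starGauge π 0 (π (inner B ξ h) v) (y - η)
  have g5 := sq_nonneg ‖π (inner B (y - η) ξ) v‖
  have g6 := vecGauge_nonneg π (π (inner B ξ h) v) (y - η)
  rw [starGauge]
  linarith

/-- Every vector of the unit ball of a Hilbert module over a unital C⋆-algebra is of the form
`2 η (1 + ⟪η, η⟫)⁻¹`. -/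
theorem exists_transform_eq (ξ : E) (hξ : ‖ξ‖ ≤ 1) : ∃ (η : E) (n : B),
    n * (1 + inner B η η) = 1 ∧ (1 + inner B η η) * n = 1 ∧
      ξ = (2 : ℂ) • MulOpposite.op n • η := by
  have hd0 : 0 ≤ inner B ξ ξ := inner_self_nonneg ξ
  have hd1 : inner B ξ ξ ≤ 1 := by
    rw [← CStarAlgebra.norm_le_one_iff_of_nonneg _ hd0, ← norm_sq_eq]
    exact pow_le_one₀ (norm_nonneg _) hξ
  -- solving `ξ = 2 η (1 + ⟪η, η⟫)⁻¹` gives `η = ξ (1 + s)⁻¹` with `s = (1 - ⟪ξ, ξ⟫) ^ (1 / 2)`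
  set s : B := CFC.sqrt (1 - inner B ξ ξ)
  have hs0 : 0 ≤ s := CFC.sqrt_nonneg _
  have hss : s * s = 1 - inner B ξ ξ := CFC.sqrt_mul_sqrt_self _ (sub_nonneg.mpr hd1)
  have hsa : star s = s := (IsSelfAdjoint.of_nonneg hs0).star_eq
  have hu : IsUnit (1 + s) :=
    CStarAlgebra.isUnit_of_le 1 (le_add_of_nonneg_right hs0)
  obtain ⟨u, hu⟩ := hu
  set r : B := ↑u⁻¹ with hr
  have hr1 : r * (1 + s) = 1 := by rw [← hu, hr]; simp
  have hr2 : (1 + s) * r = 1 := by rw [← hu, hr]; simp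
  have hrs : star r = r := by
    have h := congr(star $hr1)
    rw [star_mul, star_add, star_one, hsa] at h
    exact (left_inv_eq_right_inv hr1 h).symm
  have hb : 1 + star r * (inner B ξ ξ * r) = r + r := by
    have hd : inner B ξ ξ = 1 - s * s := by rw [hss]; abel
    rw [hrs, hd]
    calc 1 + r * ((1 - s * s) * r) = (r * (1 + s)) * ((1 + s) * r) + r * ((1 - s * s) * r) := by
          rw [hr1, hr2, mul_one]
      _ = (r * (1 + s)) * r + r * ((1 + s) * r) := by noncomm_ring
      _ = r + r := by rw [hr1, hr2, mul_one, one_mul]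
  refine ⟨MulOpposite.op r • ξ, (1 / 2 : ℂ) • (1 + s), ?_, ?_, ?_⟩
  · rw [inner_op_smul_left, inner_op_smul_right, hb, smul_mul_assoc, mul_add, hr2, ← two_smul ℂ,
      smul_smul]
    norm_num
  · rw [inner_op_smul_left, inner_op_smul_right, hb, mul_smul_comm, add_mul, hr1, ← two_smul ℂ,
      smul_smul]
    norm_num
  · rw [← mul_op_smul, mul_smul_comm, hr1, smul_op_smul, op_one_smul, smul_smul]
    norm_num

end Gauge

section GaugeLimits

open HilbertModule

variable {B E K : Type*} [CStarAlgebra B] [PartialOrder B] [StarOrderedRing B]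
  [NormedAddCommGroup E] [NormedSpace ℂ E] [SMul Bᵐᵒᵖ E] [HilbertModule B E]
  [NormedAddCommGroup K] [InnerProductSpace ℂ K] [CompleteSpace K]
  (π : B →⋆ₐ[ℂ] (K →L[ℂ] K))

/-- On bounded sets, strong⋆ convergence `f → ξ` implies that `⟪ζ - f, ζ - f⟫ → ⟪ζ - ξ, ζ - ξ⟫`
strongly. -/
theorem tendsto_inner_sub_self {X : Type*} {l : Filter X} {f : X → E} {ξ : E} {C : ℝ}
    (hf : ∀ᶠ x in l, ‖f x‖ ≤ C)
    (h : ∀ h v, Tendsto (fun x => starGauge π h v (f x - ξ)) l (𝓝 0)) (ζ : E) (v : K) :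
    Tendsto (fun x => π (inner B (ζ - f x) (ζ - f x)) v) l
      (𝓝 (π (inner B (ζ - ξ) (ζ - ξ)) v)) := by
  have aux {w : X → K} (hw : Tendsto (fun x => ‖w x‖ ^ 2) l (𝓝 0)) : Tendsto w l (𝓝 0) := by
    rw [tendsto_zero_iff_norm_tendsto_zero]
    have := (Real.continuous_sqrt.tendsto 0).comp hw
    simpa [Function.comp_def] using this
  have t1 (k : E) : Tendsto (fun x => π (inner B (f x - ξ) k) v) l (𝓝 0) :=
    aux (squeeze_zero (fun _ => sq_nonneg _) (fun x => sq_norm_le_starGauge π k v _) (h k v))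
  have t2 (k : E) : Tendsto (fun x => π (inner B k (f x - ξ)) v) l (𝓝 0) := by
    refine aux (squeeze_zero (fun _ => sq_nonneg _) (fun x => ?_)
      (by simpa using (h 0 v).const_mul (‖k‖ ^ 2)))
    exact (sq_norm_inner_apply_le π k _ v).trans
      (mul_le_mul_of_nonneg_left (vecGauge_le_starGauge π 0 v _) (sq_nonneg _))
  have t3 : Tendsto (fun x => π (inner B (f x - ξ) (f x - ξ)) v) l (𝓝 0) := by
    refine aux (squeeze_zero' (.of_forall fun _ => sq_nonneg _) ?_
      (by simpa using (h 0 v).const_mul ((C + ‖ξ‖) ^ 2)))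
    filter_upwards [hf] with x hx
    have hb : ‖f x - ξ‖ ≤ C + ‖ξ‖ := (norm_sub_le _ _).trans (by gcongr)
    refine (sq_norm_inner_apply_le π (f x - ξ) (f x - ξ) v).trans ?_
    gcongr
    · exact vecGauge_nonneg π v _
    · exact vecGauge_le_starGauge π 0 v _
  have t := (((t3.sub (t1 (ζ - ξ))).sub (t2 (ζ - ξ))).add_const (π (inner B (ζ - ξ) (ζ - ξ)) v))
  simp only [sub_zero, zero_add] at t
  refine t.congr fun x => ?_
  have : inner B (ζ - f x) (ζ - f x) = inner B (f x - ξ) (f x - ξ) - inner B (f x - ξ) (ζ - ξ) -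
      inner B (ζ - ξ) (f x - ξ) + inner B (ζ - ξ) (ζ - ξ) := by
    simp only [HilbertModule.inner_sub_left, HilbertModule.inner_sub_right]
    abel
  rw [this, map_add, map_sub, map_sub, add_apply, sub_apply, sub_apply]

theorem tendsto_starGauge_sub_self (ζ h : E) (v : K) :
    Tendsto (fun z => starGauge π h v (z - ζ)) (𝓝 ζ) (𝓝 0) := by
  have : Tendsto (fun z => (‖v‖ ^ 2 + vecGauge π v h) * ‖z - ζ‖ ^ 2) (𝓝 ζ) (𝓝 0) := by
    have h : Continuous fun z => (‖v‖ ^ 2 + vecGauge π v h) * ‖z - ζ‖ ^ 2 := by fun_prop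
    simpa using h.tendsto ζ
  exact squeeze_zero (fun _ => starGauge_nonneg π h v _) (fun _ => starGauge_le π h v _) this

/-- `ζ` is adherent to the range of `f` in the strong⋆ topology. -/
def StrongStarAdherent {Y : Type*} (f : Y → E) (ζ : E) : Prop :=
  ∀ (T : Finset (E × K)) (ε : ℝ), 0 < ε → ∃ y, ∀ p ∈ T, starGauge π p.1 p.2 (f y - ζ) < ε

variable {π}

theorem StrongStarAdherent.exists_tendsto {Y : Type*} {f : Y → E} {ζ : E}
    (h : StrongStarAdherent π f ζ) : ∃ l : Filter Y, l.NeBot ∧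
      ∀ k v, Tendsto (fun y => starGauge π k v (f y - ζ)) l (𝓝 0) := by
  classical
  let S (i : Finset (E × K) × ℕ) : Set Y :=
    {y | ∀ p ∈ i.1, starGauge π p.1 p.2 (f y - ζ) < 1 / ((i.2 : ℝ) + 1)}
  have hS : Antitone S := fun i j hij y hy p hp =>
    (hy p (hij.1 hp)).trans_le (Nat.one_div_le_one_div hij.2)
  refine ⟨⨅ i, 𝓟 (S i), ?_, fun k v => ?_⟩
  · have : Nonempty (Finset (E × K) × ℕ) := inferInstance
    refine iInf_neBot_of_directed' ?_ fun i => ?_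
    · exact directed_of_isDirected_le fun i j hij => principal_mono.mpr (hS hij)
    · exact principal_neBot_iff.mpr (h i.1 _ Nat.one_div_pos_of_nat)
  · rw [Metric.tendsto_nhds]
    intro ε hε
    obtain ⟨n, hn⟩ := exists_nat_one_div_lt hε
    refine mem_iInf_of_mem ({(k, v)}, n) (mem_principal.mpr fun y hy => ?_)
    have := hy (k, v) (by simp)
    rw [Set.mem_ofPred_eq, Real.dist_eq, sub_zero, abs_of_nonneg (starGauge_nonneg π k v _)]
    exact this.trans hn

theorem isClosed_setOf_strongStarAdherent {Y : Type*} (f : Y → E) :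
    IsClosed {ζ | StrongStarAdherent π f ζ} := by
  refine isClosed_of_closure_subset fun ζ hζ T ε hε => ?_
  have h1 : ∀ᶠ z in 𝓝 ζ, ∀ p ∈ T, starGauge π p.1 p.2 (z - ζ) < ε / 4 :=
    (Finset.eventually_all T).mpr fun p _ =>
      (tendsto_starGauge_sub_self π ζ p.1 p.2).eventually_lt_const (by positivity)
  obtain ⟨z, hz, hzT⟩ := ((mem_closure_iff_frequently.mp hζ).and_eventually h1).exists
  obtain ⟨y, hy⟩ := hz T (ε / 4) (by positivity)
  refine ⟨y, fun p hp => ?_⟩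
  have := starGauge_add_le π p.1 p.2 (f y - z) (z - ζ)
  rw [sub_add_sub_cancel] at this
  linarith [hy p hp, hzT p hp]

end GaugeLimits

/-! ### The submodule `H` of `H • B` -/

section ToExt

open HilbertModule

variable {A B H : Type*} [NonUnitalCStarAlgebra A] [PartialOrder A] [StarOrderedRing A]
  [CStarAlgebra B] [PartialOrder B] [StarOrderedRing B] (φ : A →⋆ₙₐ[ℂ] B)
  [NormedAddCommGroup H] [NormedSpace ℂ H] [SMul Aᵐᵒᵖ H] [HilbertModule A H]

theorem toExt_add (x y : H) : toExt φ (x + y) = toExt φ x + toExt φ y := by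
  rw [toExt, toExt, toExt, ← UniformSpace.Completion.coe_add]
  exact congrArg _ (TensorProduct.add_tmul x y (1 : B))

theorem toExt_smul (c : ℂ) (x : H) : toExt φ (c • x) = c • toExt φ x := by
  rw [toExt, toExt, ← UniformSpace.Completion.coe_smul]
  exact congrArg _ (TensorProduct.smul_tmul' c x (1 : B)).symm

theorem toExt_sub (x y : H) : toExt φ (x - y) = toExt φ x - toExt φ y := by
  rw [sub_eq_add_neg, toExt_add, ← neg_one_smul ℂ y, toExt_smul, neg_one_smul, sub_eq_add_neg]

theorem toExt_zero : toExt φ (0 : H) = 0 := by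
  rw [← sub_self (0 : H), toExt_sub, sub_self]

theorem inner_toExt (x y : H) : inner B (toExt φ x) (toExt φ y) = φ (inner A x y) := by
  rw [toExt, toExt, Ext.inner_coe, PreExt.inner_tmul, star_one, one_mul, mul_one]

theorem coe_tmul (x : H) (b : B) :
    ((PreExt.tmul φ x b : PreExt φ H) : Ext φ H) = MulOpposite.op b • toExt φ x := by
  rw [toExt, ← Ext.coe_op_smul, PreExt.op_smul_tmul, one_mul]

/-- `x a ⊗ 1` and `x ⊗ φ a` are identified in `H • B`. -/
theorem toExt_op_smul (a : A) (x : H) :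
    toExt φ (MulOpposite.op a • x) = MulOpposite.op (φ a) • toExt φ x := by
  rw [← sub_eq_zero]
  refine eq_zero_of_inner_self (A := B) _ ?_
  simp only [HilbertModule.inner_sub_left, HilbertModule.inner_sub_right, inner_toExt,
    inner_op_smul_left, inner_op_smul_right, map_mul, map_star, mul_assoc, sub_self,
    zero_mul]

theorem norm_toExt_le (x : H) : ‖toExt φ x‖ ≤ ‖x‖ := by
  rw [norm_eq_sqrt (A := B) (toExt φ x), norm_eq_sqrt (A := A) x, inner_toExt]
  exact Real.sqrt_le_sqrt (NonUnitalStarAlgHom.norm_apply_le φ _)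

/-- For `a ≥ 0` the element `c = a (1 + a)⁻¹`, which makes sense in a non-unital algebra. -/
theorem exists_quasiResolvent {a : A} (ha : 0 ≤ a) : ∃ c : A, star c = c ∧ c + a * c = a ∧
    c + c * a = a ∧ ‖c - c * c‖ ≤ 1 / 4 := by
  have hsa : IsSelfAdjoint a := .of_nonneg ha
  let f : ℝ → ℝ := fun t => t / (1 + t)
  have hpos (t : ℝ) (ht : t ∈ quasispectrum ℝ a) : 0 ≤ t := quasispectrum_nonneg_of_nonneg a ha t ht
  have hf : ContinuousOn f (quasispectrum ℝ a) := by
    refine continuousOn_id.div (by fun_prop) fun t ht => ?_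
    have := hpos t ht
    positivity
  have hf0 : f 0 = 0 := by simp [f]
  have h1 : a * cfcₙ f a = cfcₙ (fun t => t * f t) a := by
    conv_lhs => rw [← cfcₙ_id' ℝ a]
    rw [cfcₙ_id' ℝ a, cfcₙ_mul (fun t => t) f a (by fun_prop) (by simp) hf hf0, cfcₙ_id' ℝ a]
  have h2 : cfcₙ f a + a * cfcₙ f a = a := by
    rw [h1, ← cfcₙ_add f (fun t => t * f t) a hf hf0 (continuousOn_id.mul hf) (by simp)]
    conv_rhs => rw [← cfcₙ_id' ℝ a]
    refine cfcₙ_congr fun t ht => ?_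
    have := hpos t ht
    simp only [f]
    field_simp
  have hstar : star (cfcₙ f a) = cfcₙ f a := (cfcₙ_predicate f a : IsSelfAdjoint _).star_eq
  refine ⟨cfcₙ f a, hstar, h2, ?_, ?_⟩
  · have := congr(star $h2)
    rwa [star_add, star_mul, hstar, hsa.star_eq] at this
  · rw [← cfcₙ_mul f f a hf hf0 hf hf0,
      ← cfcₙ_sub f (fun t => f t * f t) a hf hf0 (hf.mul hf) (by simp [hf0])]
    refine norm_cfcₙ_le fun t ht => ?_
    have h0 := hpos t ht
    have hf1 : f t ≤ 1 := div_le_one_of_le₀ (by linarith) (by linarith)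
    have hf2 : 0 ≤ f t := by positivity
    rw [Real.norm_eq_abs, abs_le]
    constructor <;> nlinarith [sq_nonneg (1 - 2 * f t)]

/-- `H` is stable under the transform `y ↦ 2 y (1 + ⟪y, y⟫)⁻¹`, which maps it into its unit ball. -/
theorem exists_toExt_eq_transform (y : H) : ∃ (x : H) (m : B), ‖x‖ ≤ 1 ∧
    m * (1 + inner B (toExt φ y) (toExt φ y)) = 1 ∧
    (1 + inner B (toExt φ y) (toExt φ y)) * m = 1 ∧
    toExt φ x = (2 : ℂ) • MulOpposite.op m • toExt φ y := by
  obtain ⟨c, hc, h1, h2, h3⟩ := exists_quasiResolvent (inner_self_nonneg (A := A) y)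
  have e1 := congr(φ $h1)
  have e2 := congr(φ $h2)
  rw [map_add, map_mul] at e1 e2
  refine ⟨(2 : ℂ) • (y - MulOpposite.op c • y), 1 - φ c, ?_, ?_, ?_, ?_⟩
  -- `⟪x, x⟫ = 4 a (1 + a)⁻² = 4 (c - c ^ 2)`, where `a = ⟪y, y⟫`
  · have h4 : inner A (y - MulOpposite.op c • y) (y - MulOpposite.op c • y) = c - c * c := by
      simp only [HilbertModule.inner_sub_left, HilbertModule.inner_sub_right, inner_op_smul_left,
        inner_op_smul_right, hc]
      have h5 : inner A y y - inner A y y * c = c := by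
        rw [sub_eq_iff_eq_add]; exact h1.symm
      rw [sub_mul, mul_assoc, sub_sub_sub_comm, ← mul_sub, h5]
    rw [norm_smul, norm_eq_sqrt (A := A) (y - _), h4, Complex.norm_ofNat]
    have : √‖c - c * c‖ ≤ 1 / 2 := by
      rw [Real.sqrt_le_left (by norm_num)]
      linarith
    linarith
  · rw [inner_toExt, sub_mul, mul_add, mul_add, one_mul, mul_one, one_mul, e2]
    abel
  · rw [inner_toExt, mul_sub, add_mul, add_mul, one_mul, mul_one, one_mul, e1]
    abel
  · rw [toExt_smul, toExt_sub, toExt_op_smul, HilbertModule.sub_op_smul, op_one_smul]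

end ToExt

/-! ### Density of `H` in `H • A⋆⋆` -/

section Density

open HilbertModule

variable {A H : Type*} [NonUnitalCStarAlgebra A] [PartialOrder A] [StarOrderedRing A]
  [NormedAddCommGroup H] [NormedSpace ℂ H] [SMul Aᵐᵒᵖ H] [HilbertModule A H]

theorem strongStarAdherent_tmul (x : H) (b : Bidual A) :
    StrongStarAdherent (Bidual.toCLM A) (toExt (toBidual A) (H := H))
      (MulOpposite.op b • toExt (toBidual A) x) := by
  intro T ε hε
  set z := toExt (toBidual A) x
  set δ := √(ε / (‖z‖ ^ 2 + 1))
  have hδ : 0 < δ := by positivity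
  have hδ2 : (‖z‖ ^ 2 + 1) * δ ^ 2 = ε := by
    rw [Real.sq_sqrt (by positivity)]
    field_simp
  obtain ⟨a, ha⟩ := exists_univRep_close
    (Sum.elim (fun p : T => p.1.2) fun p : T => Bidual.toCLM A (inner (Bidual A) z p.1.1) p.1.2)
    (b := Bidual.toCLM A b) b.2 hδ
  refine ⟨MulOpposite.op a • x, fun p hp => ?_⟩
  have h1 := (ha (.inl ⟨p, hp⟩)).1
  have h2 := (ha (.inr ⟨p, hp⟩)).2
  have e : univRep A a - Bidual.toCLM A b = Bidual.toCLM A (toBidual A a - b) := by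
    rw [map_sub]; rfl
  rw [e] at h1 h2
  simp only [Sum.elim_inl, Sum.elim_inr] at h1 h2
  rw [toExt_op_smul, ← HilbertModule.sub_op_smul, starGauge, vecGauge_op_smul,
    inner_op_smul_left, map_mul, map_star]
  change _ + ‖star (Bidual.toCLM A (toBidual A a - b))
    (Bidual.toCLM A (inner (Bidual A) z p.1) p.2)‖ ^ 2 < ε
  have h3 := vecGauge_le (Bidual.toCLM A) (Bidual.toCLM A (toBidual A a - b) p.2) z
  have h4 : ‖Bidual.toCLM A (toBidual A a - b) p.2‖ ^ 2 ≤ δ ^ 2 := by gcongr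
  have h5 := pow_lt_pow_left₀ h2 (norm_nonneg _) two_ne_zero
  have h6 := mul_le_mul_of_nonneg_left h4 (sq_nonneg ‖z‖)
  linarith

theorem StrongStarAdherent.add {ζ ζ' : BidualExt A H}
    (h : StrongStarAdherent (Bidual.toCLM A) (toExt (toBidual A) (H := H)) ζ)
    (h' : StrongStarAdherent (Bidual.toCLM A) (toExt (toBidual A) (H := H)) ζ') :
    StrongStarAdherent (Bidual.toCLM A) (toExt (toBidual A) (H := H)) (ζ + ζ') := by
  intro T ε hε
  obtain ⟨y, hy⟩ := h T (ε / 4) (by positivity)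
  obtain ⟨y', hy'⟩ := h' T (ε / 4) (by positivity)
  refine ⟨y + y', fun p hp => ?_⟩
  have := starGauge_add_le (Bidual.toCLM A) p.1 p.2 (toExt (toBidual A) y - ζ)
    (toExt (toBidual A) y' - ζ')
  rw [toExt_add, add_sub_add_comm]
  linarith [hy p hp, hy' p hp]

/-- `H` is strong⋆ dense in `H • A⋆⋆`, without control of the norm. -/
theorem strongStarAdherent_toExt (ζ : BidualExt A H) :
    StrongStarAdherent (Bidual.toCLM A) (toExt (toBidual A) (H := H)) ζ := by
  induction ζ using UniformSpace.Completion.induction_on with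
  | hp => exact isClosed_setOf_strongStarAdherent _
  | ih z =>
    obtain ⟨n, x, b, rfl⟩ := PreExt.exists_eq_sum z
    refine Finset.sum_induction _ (fun z : PreExt (toBidual A) H =>
      StrongStarAdherent (Bidual.toCLM A) (toExt (toBidual A) (H := H)) (z : BidualExt A H))
      (fun z w hz hw => ?_) ?_ fun i _ => ?_
    · rw [UniformSpace.Completion.coe_add]
      exact hz.add hw
    · rw [UniformSpace.Completion.coe_zero, ← toExt_zero (toBidual A) (H := H)]
      refine fun T ε hε => ⟨0, fun p _ => ?_⟩
      rw [sub_self]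
      exact (starGauge_le _ _ _ _).trans_lt (by simpa using hε)
    · rw [coe_tmul]
      exact strongStarAdherent_tmul (x i) (b i)

/-- The unit ball of `H` is strong⋆ dense in that of `H • A⋆⋆`. -/
theorem exists_tendsto_starGauge (ξ : BidualExt A H) (hξ : ‖ξ‖ ≤ 1) :
    ∃ l : Filter H, l.NeBot ∧ (∀ᶠ x in l, ‖x‖ ≤ 1) ∧ ∀ h v,
      Tendsto (fun x => starGauge (Bidual.toCLM A) h v (toExt (toBidual A) x - ξ)) l (𝓝 0) := by
  obtain ⟨η, n, hn, hn', hξη⟩ := exists_transform_eq (B := Bidual A) ξ hξ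
  obtain ⟨l, hl, hlη⟩ := (strongStarAdherent_toExt η).exists_tendsto
  choose x m hx hm hm' hxm using exists_toExt_eq_transform (toBidual A) (H := H)
  refine ⟨l.map x, hl.map x, eventually_map.mpr (.of_forall hx), fun h v => ?_⟩
  rw [tendsto_map'_iff]
  refine squeeze_zero (fun _ => starGauge_nonneg _ _ _ _) (fun y =>
    starGauge_transform_sub_le (Bidual.toCLM A) (hm y) (hm' y) hn hn' (hxm y) hξη
      ((norm_toExt_le _ _).trans (hx y)) h v) ?_
  simpa using ((((hlη 0 _).add (hlη ξ v)).add (hlη (resolvent η n h) v)).add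
    (hlη 0 _)).const_mul 8

end Density

end HilbertMod

end

theorem theoremP1 (A : Type*) [NonUnitalCStarAlgebra A] [PartialOrder A]
    [StarOrderedRing A] (H : Type*) [NormedAddCommGroup H] [NormedSpace ℂ H] [SMul Aᵐᵒᵖ H]
    [HilbertMod.HilbertModule A H] [CompleteSpace H] :
    HilbertMod.toExt (HilbertMod.toBidual A) '' Metric.closedBall (0 : H) 1 ⊆
        Metric.closedBall (0 : HilbertMod.BidualExt A H) 1 ∧
      Metric.closedBall (0 : HilbertMod.BidualExt A H) 1 ⊆
        closure[HilbertMod.topSU A H]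
          (HilbertMod.toExt (HilbertMod.toBidual A) '' Metric.closedBall (0 : H) 1) ∧
      ∀ ξ : HilbertMod.BidualExt A H, ‖ξ‖ ≤ 1 →
        ∃ l : Filter H, l.NeBot ∧ (∀ᶠ x in l, ‖x‖ ≤ 1) ∧
          ∀ v : HilbertMod.UnivSpace A,
            Filter.Tendsto (fun x : H =>
              ‖HilbertMod.Bidual.toCLM A (inner (HilbertMod.Bidual A)
                (ξ - HilbertMod.toExt (HilbertMod.toBidual A) x)
                (ξ - HilbertMod.toExt (HilbertMod.toBidual A) x)) v‖) l (nhds 0) := by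
  have key (ξ : HilbertMod.BidualExt A H) (hξ : ‖ξ‖ ≤ 1) :
      ∃ l : Filter H, l.NeBot ∧ (∀ᶠ x in l, ‖x‖ ≤ 1) ∧ ∀ ζ v,
        Filter.Tendsto (fun x : H =>
          ‖HilbertMod.Bidual.toCLM A (inner (HilbertMod.Bidual A)
            (ζ - HilbertMod.toExt (HilbertMod.toBidual A) x)
            (ζ - HilbertMod.toExt (HilbertMod.toBidual A) x)) v‖) l
          (nhds ‖HilbertMod.Bidual.toCLM A (inner (HilbertMod.Bidual A) (ζ - ξ) (ζ - ξ)) v‖) := by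
    obtain ⟨l, hl, hl1, hlξ⟩ := HilbertMod.exists_tendsto_starGauge ξ hξ
    exact ⟨l, hl, hl1, fun ζ v => (HilbertMod.tendsto_inner_sub_self _
      (hl1.mono fun x hx => (HilbertMod.norm_toExt_le _ x).trans hx) hlξ ζ v).norm⟩
  refine ⟨?_, fun ξ hξ => ?_, fun ξ hξ => ?_⟩
  · rintro _ ⟨x, hx, rfl⟩
    rw [mem_closedBall_zero_iff] at hx ⊢
    exact (HilbertMod.norm_toExt_le _ x).trans hx
  · obtain ⟨l, hl, hl1, hlξ⟩ := key ξ (mem_closedBall_zero_iff.mp hξ)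
    have ht : Filter.Tendsto (HilbertMod.toExt (HilbertMod.toBidual A) (H := H)) l
        (@nhds _ (HilbertMod.topSU A H) ξ) := by
      rw [TopologicalSpace.tendsto_nhds_generateFrom_iff]
      rintro _ ⟨ζ, ε, V, hε, rfl⟩ hξV
      exact (Finset.eventually_all V).mpr fun v hv => (hlξ ζ v).eventually_lt_const (hξV v hv)
    exact @mem_closure_of_tendsto _ (HilbertMod.topSU A H) _ _ _ _ _ hl ht
      (hl1.mono fun x hx => ⟨x, mem_closedBall_zero_iff.mpr hx, rfl⟩)
  · obtain ⟨l, hl, hl1, hlξ⟩ := key ξ hξ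
    refine ⟨l, hl, hl1, fun v => ?_⟩
    have := hlξ ξ v
    rwa [sub_self, show inner (HilbertMod.Bidual A) (0 : HilbertMod.BidualExt A H) 0 = 0 by
      rw [← sub_self (0 : HilbertMod.BidualExt A H), HilbertMod.HilbertModule.inner_sub_right,
        sub_self], map_zero, zero_apply, norm_zero] at this
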